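/- Let $(\varepsilon_t)_{t\ge1}$ be i.i.d. with mean $0$ and variance $\sigma^2>0$, let $x_t\in\mathbb R^p$ be non-stochastic, $\delta,g\in\mathbb R^p$ with $g\neq0$, and for each $n$ let $y_t=\theta'x_t+\varepsilon_t$, $t=1,\dots,n$, with $\theta=\theta_n=\delta n^{-1/2}$. Put $S_{xx}=n^{-1}\sum_{t=1}^n x_tx_t'$, $S_{xy}=n^{-1}\sum_{t=1}^n x_ty_t$, $\tilde S_{xx}=S_{xx}+n^{-1}c_nI_p$, $\tilde\theta_n=\tilde S_{xx}^{-1}S_{xy}$, $\hat\theta_n=S_{xx}^{-1}S_{xy}$. Assume that $S_{xx}$ is nonsingular for all large $n$ and converges to a positive definite matrix $\Sigma_{xx}$, and that $n^{-1}c_n\to c_0\ge0$. Assume the null hypothesis $g'\theta_n=r_n$ for every $n\ge 1$. Define $$T_n=n^{1/2}(g'\tilde\theta_n-r_n),\quad B_n=-c_nn^{-1/2}g'\tilde S_{xx}^{-1}\theta_n,\quad \hat B_n=-c_nn^{-1/2}g'\tilde S_{xx}^{-1}\hat\theta_n .$$ Let $(x_t^*,y_t^*)$, $t=1,\dots,n$,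 be drawn i.i.d. uniformly from the pairs $(x_t,y_t)$, $t=1,\dots,n$ (with bootstrap probability $P^*$, given the data), and $T_n^*=n^{1/2}g'(\tilde\theta_n^*-\hat\theta_n)$, where $\tilde\theta_n^*$ is the ridge estimator (with the same $c_n$) computed from the resampled pairs. Let $\tilde\Sigma_{xx}=\Sigma_{xx}+c_0I_p$, $$V=(v_{ij})=\sigma^2\begin{pmatrix} g'\tilde\Sigma_{xx}^{-1}\Sigma_{xx}\tilde\Sigma_{xx}^{-1}g & -c_0g'\tilde\Sigma_{xx}^{-1}\tilde\Sigma_{xx}^{-1}g\\ -c_0g'\tilde\Sigma_{xx}^{-1}\tilde\Sigma_{xx}^{-1}g & c_0^2g'\tilde\Sigma_{xx}^{-1}\Sigma_{xx}^{-1}\tilde\Sigma_{xx}^{-1}g\end{pmatrix},\qquad (\xi_1,\xi_2)'\sim N(0,V).$$ (a) If $\max_{t\le n}x_t'x_t=o(n)$, then the following hold. Assumption 1: $T_n-B_n\to_d\xi_1$, where $\xi_1$ has mean zero and its cdf is continuous and strictly increasing over its support. Assumption 2(ii): $(T_n-B_n,\hat B_n-B_n)'\to_d(\xi_1,\xi_2)'$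 jointly, where $\xi_2$ has mean zero and $\xi_1-\xi_2$ has a continuous cdf. (b) If $\max_{t\le n}x_t'x_t=o(n^{1/2})$ and $E\varepsilon_t^4<\infty$, then Assumptions 1 and 2 hold; that is, in addition to the conclusions of (a), $\hat B_n$ is measurable with respect to the data and $T_n^*-\hat B_n$ converges in distribution to $\xi_1$ under $P^*$, in probability: $P^*(T_n^*-\hat B_n\le u)\to_p P(\xi_1\le u)$ at every continuity point $u$ of the cdf of $\xi_1$. (c) $V$ is positive semidefinite with $v_{11}>0$; $v_{22}>0$ if and only if $c_0>0$; $V$ is positive definite if and only if $c_0>0$ and $g$ is not an eigenvector of $\Sigma_{xx}$; $V$ is a continuous function of $(c_0,\sigma^2,\Sigma_{xx})$ on the set where $c_0\ge0$, $\sigma^2>0$ and $\Sigma_{xx}$ is positive definite; and $$m^2:=\frac{v_{11}+v_{22}-2v_{12}}{v_{11}}=\frac{g'\Sigma_{xx}^{-1}g}{g'\tilde\Sigma_{xx}^{-1}\Sigma_{xx}\tilde\Sigma_{xx}^{-1}g}.$$ -/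

import Mathlib

open Filter Topology MeasureTheory ProbabilityTheory Matrix Asymptotics

noncomputable section

namespace RidgeBootstrap

/-! ### High-level conditions on a statistic and its bootstrap analogue -/

section HighLevel

variable {Ω Ω' : Type*} [MeasurableSpace Ω] [MeasurableSpace Ω']

/-- The distribution function `u ↦ P(ξ ≤ u)` of a real random variable. -/
def distFun (P' : Measure Ω') (ξ : Ω' → ℝ) (u : ℝ) : ℝ := P'.real {ω | ξ ω ≤ u}

/-- A random variable is centered at zero: it is integrable with mean zero. -/
def CenteredAtZero (P' : Measure Ω') (ξ : Ω' → ℝ) : Prop :=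
  Integrable ξ P' ∧ ∫ ω, ξ ω ∂P' = 0

/-- High-level condition on the statistic: `T_n - B_n` converges in distribution to `ξ₁`, which is centered at zero and
whose distribution function is continuous, and strictly increasing over the support of `ξ₁`. -/
structure Assumption1 (P : Measure Ω) [IsProbabilityMeasure P]
    (P' : Measure Ω') [IsProbabilityMeasure P']
    (T B : ℕ → Ω → ℝ) (ξ₁ : Ω' → ℝ) : Prop where
  tendsto : TendstoInDistribution (fun n ω => T n ω - B n ω) atTop ξ₁ (fun _ => P) P'
  centered : CenteredAtZero P' ξ₁
  continuous_cdf : Continuous (distFun P' ξ₁)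
  strictMono_cdf : StrictMonoOn (distFun P' ξ₁) (P'.map ξ₁).support

/-- Convergence in distribution of bootstrap statistics `Y_n*` to `ξ`, in probability: for every
continuity point `u` of the distribution function `G` of `ξ`, `P*(Y_n* ≤ u) - G(u) → 0` in
`P`-probability. Here `Pstar n ω` is the bootstrap probability (on the space `Ωs n` of bootstrap
draws) given the data of size `n` at the outcome `ω`. -/
def BootTendstoInDistribution (P : Measure Ω) (P' : Measure Ω')
    {Ωs : ℕ → Type*} [∀ n, MeasurableSpace (Ωs n)] (Pstar : ∀ n, Ω → Measure (Ωs n))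
    (Y : ∀ n, Ω → Ωs n → ℝ) (ξ : Ω' → ℝ) : Prop :=
  ∀ u : ℝ, ContinuousAt (distFun P' ξ) u →
    TendstoInMeasure P (fun n ω => (Pstar n ω).real {s | Y n ω s ≤ u} - distFun P' ξ u)
      atTop (fun _ => 0)

/-- High-level joint condition: joint convergence in distribution of `(T_n - B_n, B̂_n - B_n)` to
`(ξ₁, ξ₂)`, where `ξ₂` is centered at zero and `ξ₁ - ξ₂` has a continuous distribution
function. -/
structure Assumption2ii (P : Measure Ω) [IsProbabilityMeasure P]
    (P' : Measure Ω') [IsProbabilityMeasure P']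
    (T B Bhat : ℕ → Ω → ℝ) (ξ₁ ξ₂ : Ω' → ℝ) : Prop where
  tendsto : TendstoInDistribution (fun n ω => (T n ω - B n ω, Bhat n ω - B n ω)) atTop
    (fun ω' => (ξ₁ ω', ξ₂ ω')) (fun _ => P) P'
  centered : CenteredAtZero P' ξ₂
  continuous_cdf : Continuous (distFun P' fun ω' => ξ₁ ω' - ξ₂ ω')

/-- High-level condition on the bootstrap, for the given `B̂_n`: `B̂_n` is measurable with respect to the data `D_n`,
(i) `T_n* - B̂_n` converges in distribution to `ξ₁`, in probability, and (ii) the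
joint condition above holds. -/
structure Assumption2 (P : Measure Ω) [IsProbabilityMeasure P]
    (P' : Measure Ω') [IsProbabilityMeasure P'] (D : ℕ → MeasurableSpace Ω)
    {Ωs : ℕ → Type*} [∀ n, MeasurableSpace (Ωs n)] (Pstar : ∀ n, Ω → Measure (Ωs n))
    (T B Bhat : ℕ → Ω → ℝ) (Tstar : ∀ n, Ω → Ωs n → ℝ) (ξ₁ ξ₂ : Ω' → ℝ) : Prop where
  measurable_Bhat : ∀ n, Measurable[D n] (Bhat n)
  boot : BootTendstoInDistribution P P' Pstar (fun n ω s => Tstar n ω s - Bhat n ω) ξ₁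
  joint : Assumption2ii P P' T B Bhat ξ₁ ξ₂

end HighLevel

/-! ### Ridge and least squares estimators for a sample of size `n` -/

section Estimators

variable {n p : ℕ}

/-- `S_xx = n⁻¹ ∑ x_t x_t'`. -/
def Sxx (xs : Fin n → Fin p → ℝ) : Matrix (Fin p) (Fin p) ℝ :=
  (n : ℝ)⁻¹ • ∑ t, vecMulVec (xs t) (xs t)

/-- `S_xy = n⁻¹ ∑ x_t y_t`. -/
def Sxy (xs : Fin n → Fin p → ℝ) (ys : Fin n → ℝ) : Fin p → ℝ :=
  (n : ℝ)⁻¹ • ∑ t, ys t • xs t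

/-- `S̃_xx = S_xx + n⁻¹ c I_p`. -/
def SxxRidge (c : ℝ) (xs : Fin n → Fin p → ℝ) : Matrix (Fin p) (Fin p) ℝ :=
  Sxx xs + ((n : ℝ)⁻¹ * c) • (1 : Matrix (Fin p) (Fin p) ℝ)

/-- The ridge estimator `S̃_xx⁻¹ S_xy`. -/
def ridge (c : ℝ) (xs : Fin n → Fin p → ℝ) (ys : Fin n → ℝ) : Fin p → ℝ :=
  (SxxRidge c xs)⁻¹ *ᵥ Sxy xs ys

/-- The least squares estimator `S_xx⁻¹ S_xy`. -/
def ols (xs : Fin n → Fin p → ℝ) (ys : Fin n → ℝ) : Fin p → ℝ :=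
  (Sxx xs)⁻¹ *ᵥ Sxy xs ys

end Estimators

/-! ### The model with local-to-zero coefficients, the statistics, and the pairs bootstrap

Observations are indexed from `0`: the sample of size `n` consists of `t = 0, …, n - 1`. -/

section Model

variable {Ω : Type*} {p : ℕ}

/-- The regressors in the sample of size `n`. -/
def xData (x : ℕ → Fin p → ℝ) (n : ℕ) : Fin n → Fin p → ℝ := fun t => x t

/-- The local-to-zero coefficient `θ = δ n^{-1/2}`. -/
def theta (δ : Fin p → ℝ) (n : ℕ) : Fin p → ℝ := (√(n : ℝ))⁻¹ • δ

/-- The dependent variable `y_t = θ' x_t + ε_t` in the sample of size `n`. -/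
def yData (x : ℕ → Fin p → ℝ) (δ : Fin p → ℝ) (ε : ℕ → Ω → ℝ) (n : ℕ) (ω : Ω) : Fin n → ℝ :=
  fun t => theta δ n ⬝ᵥ x t + ε t ω

/-- The σ-algebra generated by the data `D_n` (the regressors are non-stochastic). -/
abbrev dataSigma (x : ℕ → Fin p → ℝ) (δ : Fin p → ℝ) (ε : ℕ → Ω → ℝ) (n : ℕ) :
    MeasurableSpace Ω :=
  MeasurableSpace.comap (yData x δ ε n) inferInstance

/-- `T_n = n^{1/2} (g'θ̃_n - r)`. -/
def Tstat (x : ℕ → Fin p → ℝ) (δ : Fin p → ℝ) (ε : ℕ → Ω → ℝ) (c : ℕ → ℝ)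
    (g : Fin p → ℝ) (r : ℕ → ℝ) (n : ℕ) (ω : Ω) : ℝ :=
  √(n : ℝ) * (g ⬝ᵥ ridge (c n) (xData x n) (yData x δ ε n ω) - r n)

/-- `B_n = -c_n n^{-1/2} g' S̃_xx⁻¹ θ` (non-random). -/
def Bias (x : ℕ → Fin p → ℝ) (δ : Fin p → ℝ) (c : ℕ → ℝ) (g : Fin p → ℝ) (n : ℕ) : ℝ :=
  -(c n) * (√(n : ℝ))⁻¹ * (g ⬝ᵥ (SxxRidge (c n) (xData x n))⁻¹ *ᵥ theta δ n)

/-- `B̂_n = -c_n n^{-1/2} g' S̃_xx⁻¹ θ̂_n`, with `θ̂_n` the least squares estimator. -/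
def BiasHat (x : ℕ → Fin p → ℝ) (δ : Fin p → ℝ) (ε : ℕ → Ω → ℝ) (c : ℕ → ℝ)
    (g : Fin p → ℝ) (n : ℕ) (ω : Ω) : ℝ :=
  -(c n) * (√(n : ℝ))⁻¹ *
    (g ⬝ᵥ (SxxRidge (c n) (xData x n))⁻¹ *ᵥ ols (xData x n) (yData x δ ε n ω))

/-- The bootstrap probability of the pairs bootstrap: the `n` resampled indices are i.i.d. uniform
on the `n` observations. -/
def pairsLaw (n : ℕ) : Measure (Fin n → Fin n) :=
  Measure.pi fun _ => uniformOn (Set.univ : Set (Fin n))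

/-- `T_n* = n^{1/2} g'(θ̃_n* - θ̂_n)`, where `θ̃_n*` is the ridge estimator computed from the
resampled pairs `(y_{j t}, x_{j t})`. -/
def TstatBoot (x : ℕ → Fin p → ℝ) (δ : Fin p → ℝ) (ε : ℕ → Ω → ℝ) (c : ℕ → ℝ)
    (g : Fin p → ℝ) (n : ℕ) (ω : Ω) (j : Fin n → Fin n) : ℝ :=
  √(n : ℝ) * (g ⬝ᵥ
    (ridge (c n) (fun t => xData x n (j t)) (fun t => yData x δ ε n ω (j t))
      - ols (xData x n) (yData x δ ε n ω)))

variable [MeasurableSpace Ω]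

/-- The conditions common to both sets of regularity conditions: the errors are
i.i.d. `(0, σ²)` with `σ² > 0`; `S_xx` is nonsingular (once `n` is large) and converges to a
positive definite `Σ_xx`; `n⁻¹ c_n → c₀ ≥ 0`. -/
structure RidgeBase (P : Measure Ω) (x : ℕ → Fin p → ℝ) (ε : ℕ → Ω → ℝ) (c : ℕ → ℝ)
    (sigma2 c₀ : ℝ) (Sig : Matrix (Fin p) (Fin p) ℝ) : Prop where
  measurable_err : ∀ t, Measurable (ε t)
  indep : iIndepFun ε P
  identDistrib : ∀ t, IdentDistrib (ε t) (ε 0) P P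
  memLp_two : MemLp (ε 0) 2 P
  mean_zero : ∫ ω, ε 0 ω ∂P = 0
  variance_eq : Var[ε 0; P] = sigma2
  sigma2_pos : 0 < sigma2
  nonsing : ∀ᶠ n in atTop, IsUnit (Sxx (xData x n)).det
  tendsto_Sxx : Tendsto (fun n => Sxx (xData x n)) atTop (𝓝 Sig)
  posDef : Sig.PosDef
  tendsto_c : Tendsto (fun n : ℕ => (n : ℝ)⁻¹ * c n) atTop (𝓝 c₀)
  c₀_nonneg : 0 ≤ c₀

/-- Regularity conditions without the bootstrap: the common conditions, and `max_{t ≤ n} x_t'x_t = o(n)`. -/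
structure AssumptionRE (P : Measure Ω) (x : ℕ → Fin p → ℝ) (ε : ℕ → Ω → ℝ) (c : ℕ → ℝ)
    (sigma2 c₀ : ℝ) (Sig : Matrix (Fin p) (Fin p) ℝ) : Prop
    extends RidgeBase P x ε c sigma2 c₀ Sig where
  max_isLittleO : (fun n : ℕ => ⨆ t : Fin n, xData x n t ⬝ᵥ xData x n t)
    =o[atTop] fun n : ℕ => (n : ℝ)

/-- Regularity conditions for the bootstrap: the common conditions, `max_{t ≤ n} x_t'x_t = o(n^{1/2})`, and
`E ε_t⁴ < ∞`. -/
structure AssumptionRE2 (P : Measure Ω) (x : ℕ → Fin p → ℝ) (ε : ℕ → Ω → ℝ) (c : ℕ → ℝ)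
    (sigma2 c₀ : ℝ) (Sig : Matrix (Fin p) (Fin p) ℝ) : Prop
    extends RidgeBase P x ε c sigma2 c₀ Sig where
  max_isLittleO : (fun n : ℕ => ⨆ t : Fin n, xData x n t ⬝ᵥ xData x n t)
    =o[atTop] fun n : ℕ => √(n : ℝ)
  fourth_moment : Integrable (fun ω => ε 0 ω ^ 4) P

end Model

/-! ### The limiting covariance matrix -/

section Limit

variable {p : ℕ}

/-- `Σ̃_xx = Σ_xx + c₀ I_p`. -/
def SigTilde (c₀ : ℝ) (Sig : Matrix (Fin p) (Fin p) ℝ) : Matrix (Fin p) (Fin p) ℝ :=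
  Sig + c₀ • (1 : Matrix (Fin p) (Fin p) ℝ)

/-- The covariance matrix `V` of the limit `(ξ₁, ξ₂)`. -/
def V (g : Fin p → ℝ) (c₀ sigma2 : ℝ) (Sig : Matrix (Fin p) (Fin p) ℝ) :
    Matrix (Fin 2) (Fin 2) ℝ :=
  sigma2 •
    !![g ⬝ᵥ ((SigTilde c₀ Sig)⁻¹ * Sig * (SigTilde c₀ Sig)⁻¹) *ᵥ g,
       -c₀ * (g ⬝ᵥ ((SigTilde c₀ Sig)⁻¹ * (SigTilde c₀ Sig)⁻¹) *ᵥ g);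
       -c₀ * (g ⬝ᵥ ((SigTilde c₀ Sig)⁻¹ * (SigTilde c₀ Sig)⁻¹) *ᵥ g),
       c₀ ^ 2 * (g ⬝ᵥ ((SigTilde c₀ Sig)⁻¹ * Sig⁻¹ * (SigTilde c₀ Sig)⁻¹) *ᵥ g)]

/-- `m² = (v₁₁ + v₂₂ - 2 v₁₂) / v₁₁`. -/
def mSq (W : Matrix (Fin 2) (Fin 2) ℝ) : ℝ := (W 0 0 + W 1 1 - 2 * W 0 1) / W 0 0

end Limit

end RidgeBootstrap

end

/-!
Write `h = Σ̃_xx⁻¹ g`. The quadratic form of `V` at `s` is `σ² w'Σ_xx w` with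
`w = s₁ h - c₀ s₂ Σ_xx⁻¹ h` (`V_quadForm`). So `V` is a Gram matrix, degenerate exactly when `h` and
`c₀ Σ_xx⁻¹ h` are dependent, that is, when `c₀ = 0` or `g` is an eigenvector; and
`h + c₀ Σ_xx⁻¹ h = Σ_xx⁻¹ g` gives the formula for `m²`.

Under the null hypothesis `T_n - B_n` and `B̂_n - B_n` are exactly linear in the errors
(`Tstat_sub_Bias`, `BiasHat_sub_Bias`). A linear combination of them is `∑ a_t ε_t` with
`∑ a_t² → w'Σ_xx w` and `max |a_t| → 0`, the latter because `max x_t'x_t = o(n)`. A second-order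
expansion of the characteristic function of the errors (`tendsto_prod_charFun`) gives its Gaussian
limit, and Lévy's theorem in dimension two gives joint convergence.

For the bootstrap, `T_n* - B̂_n = g'S̃*⁻¹ W*`, where the score `W*` is a normalized sum of `n`
independent draws of `x ê` (centered, by the normal equations) plus a term of order
`√n (S*_xx - S_xx) θ̂`, which vanishes since `√n θ̂` is bounded in probability (`boot_stat_eq`).
For a deterministic sequence of data sets whose moments converge, a Lyapunov central limit theorem
(`tendsto_charFun_pairsLaw`) and Slutsky's theorem yield the limit (`tendsto_cdf_boot`). The moments
of the random data converge in probability by Markov's inequality, using `E ε⁴ < ∞`. Convergence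
in probability is treated as convergence along a filter (`probFilter`), through which the
deterministic statement becomes one in probability (`tendsto_probFilter_of_seq`). Of the regressors,
these moment arguments need only that `n⁻² ∑ (x_t'x_t)²` tends to zero, which already follows from
`max x_t'x_t = o(n)`; the stronger rate `o(√n)` enters only through this consequence.
-/

namespace RidgeBootstrap


/-! ### The limiting covariance matrix -/

section LinearAlgebra

variable {p : ℕ} {Sig : Matrix (Fin p) (Fin p) ℝ} {c₀ sigma2 : ℝ} {g : Fin p → ℝ}

lemma posDef_SigTilde (hS : Sig.PosDef) (hc : 0 ≤ c₀) : (SigTilde c₀ Sig).PosDef :=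
  hS.add_posSemidef (PosSemidef.one.smul hc)

lemma isUnit_det_of_posDef (hS : Sig.PosDef) : IsUnit Sig.det :=
  (isUnit_iff_isUnit_det _).mp hS.isUnit

lemma transpose_of_posDef (hS : Sig.PosDef) : Sigᵀ = Sig := by
  simpa using hS.isHermitian.eq

lemma dotProduct_mulVec_comm_of_transpose {A : Matrix (Fin p) (Fin p) ℝ} (hA : Aᵀ = A)
    (u v : Fin p → ℝ) : u ⬝ᵥ A *ᵥ v = (A *ᵥ u) ⬝ᵥ v := by
  rw [dotProduct_mulVec, ← mulVec_transpose, hA]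

lemma dotProduct_sandwich_mulVec {A : Matrix (Fin p) (Fin p) ℝ} (hA : Aᵀ = A)
    (B : Matrix (Fin p) (Fin p) ℝ) (u v : Fin p → ℝ) :
    u ⬝ᵥ (A * B * A) *ᵥ v = (A *ᵥ u) ⬝ᵥ B *ᵥ (A *ᵥ v) := by
  rw [← mulVec_mulVec, ← mulVec_mulVec, dotProduct_mulVec_comm_of_transpose hA]

lemma transpose_inv_SigTilde (hS : Sig.PosDef) (hc : 0 ≤ c₀) :
    ((SigTilde c₀ Sig)⁻¹)ᵀ = (SigTilde c₀ Sig)⁻¹ :=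
  transpose_of_posDef (posDef_SigTilde hS hc).inv

lemma V_eq (hS : Sig.PosDef) (hc : 0 ≤ c₀) (h : Fin p → ℝ)
    (hh : h = (SigTilde c₀ Sig)⁻¹ *ᵥ g) :
    V g c₀ sigma2 Sig = sigma2 • !![h ⬝ᵥ Sig *ᵥ h, -c₀ * (h ⬝ᵥ h);
      -c₀ * (h ⬝ᵥ h), c₀ ^ 2 * (h ⬝ᵥ Sig⁻¹ *ᵥ h)] := by
  have hT := transpose_inv_SigTilde hS hc
  have h1 : g ⬝ᵥ ((SigTilde c₀ Sig)⁻¹ * (SigTilde c₀ Sig)⁻¹) *ᵥ g = h ⬝ᵥ h := by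
    rw [← mulVec_mulVec, dotProduct_mulVec_comm_of_transpose hT, hh]
  rw [V, dotProduct_sandwich_mulVec hT, dotProduct_sandwich_mulVec hT, h1, ← hh]

/-- The quadratic form of `V` is a positive multiple of the quadratic form of `Σ_xx` along a curve
of vectors that is linear in `s`: this exhibits `V` as a Gram matrix. -/
lemma V_quadForm (hS : Sig.PosDef) (hc : 0 ≤ c₀) (h : Fin p → ℝ)
    (hh : h = (SigTilde c₀ Sig)⁻¹ *ᵥ g) (s : Fin 2 → ℝ) :
    s ⬝ᵥ V g c₀ sigma2 Sig *ᵥ s =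
      sigma2 * ((s 0 • h - (c₀ * s 1) • (Sig⁻¹ *ᵥ h)) ⬝ᵥ
        Sig *ᵥ (s 0 • h - (c₀ * s 1) • (Sig⁻¹ *ᵥ h))) := by
  rw [V_eq hS hc h hh]
  have hu := isUnit_det_of_posDef hS
  have e1 : Sig *ᵥ (Sig⁻¹ *ᵥ h) = h := by
    rw [mulVec_mulVec, mul_nonsing_inv _ hu, one_mulVec]
  have e2 : (Sig⁻¹ *ᵥ h) ⬝ᵥ (Sig *ᵥ h) = h ⬝ᵥ h := by
    rw [dotProduct_mulVec_comm_of_transpose (transpose_of_posDef hS), e1]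
  have e3 : (Sig⁻¹ *ᵥ h) ⬝ᵥ h = h ⬝ᵥ (Sig⁻¹ *ᵥ h) := dotProduct_comm _ _
  simp only [mulVec_sub, mulVec_smul, dotProduct_sub, sub_dotProduct, smul_dotProduct,
    dotProduct_smul, e1, e2, e3, smul_eq_mul]
  simp [Matrix.mulVec, dotProduct, Fin.sum_univ_two]
  ring

lemma SigTilde_mulVec_inv (hS : Sig.PosDef) (hc : 0 ≤ c₀) :
    Sig *ᵥ ((SigTilde c₀ Sig)⁻¹ *ᵥ g) + c₀ • ((SigTilde c₀ Sig)⁻¹ *ᵥ g) = g := by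
  have : SigTilde c₀ Sig *ᵥ ((SigTilde c₀ Sig)⁻¹ *ᵥ g) = g := by
    rw [mulVec_mulVec, mul_nonsing_inv _ (isUnit_det_of_posDef (posDef_SigTilde hS hc)),
      one_mulVec]
  conv_rhs => rw [← this]
  conv_rhs => rw [SigTilde]
  rw [add_mulVec, smul_mulVec, one_mulVec]
  rfl

lemma SigTilde_inv_mulVec_ne_zero (hS : Sig.PosDef) (hc : 0 ≤ c₀) (hg : g ≠ 0) :
    (SigTilde c₀ Sig)⁻¹ *ᵥ g ≠ 0 := by
  intro h0
  apply hg
  rw [← SigTilde_mulVec_inv (g := g) hS hc, h0]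
  simp

lemma quadForm_pos (hS : Sig.PosDef) {u : Fin p → ℝ} (hu : u ≠ 0) : 0 < u ⬝ᵥ Sig *ᵥ u := by
  simpa using hS.dotProduct_mulVec_pos hu

lemma quadForm_nonneg (hS : Sig.PosDef) (u : Fin p → ℝ) : 0 ≤ u ⬝ᵥ Sig *ᵥ u := by
  simpa using hS.posSemidef.dotProduct_mulVec_nonneg u

lemma V_isHermitian : (V g c₀ sigma2 Sig).IsHermitian := by
  ext i j
  fin_cases i <;> fin_cases j <;> simp [V]

lemma V_posSemidef (hS : Sig.PosDef) (hc : 0 ≤ c₀) (hs : 0 < sigma2) :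
    (V g c₀ sigma2 Sig).PosSemidef := by
  refine .of_dotProduct_mulVec_nonneg V_isHermitian fun s => ?_
  rw [star_trivial, V_quadForm hS hc _ rfl]
  exact mul_nonneg hs.le (quadForm_nonneg hS _)

lemma V_zero_zero_pos (hS : Sig.PosDef) (hc : 0 ≤ c₀) (hs : 0 < sigma2) (hg : g ≠ 0) :
    0 < V g c₀ sigma2 Sig 0 0 := by
  rw [V_eq hS hc _ rfl]
  simpa using mul_pos hs (quadForm_pos hS (SigTilde_inv_mulVec_ne_zero hS hc hg))

lemma V_one_one_pos_iff (hS : Sig.PosDef) (hc : 0 ≤ c₀) (hs : 0 < sigma2) (hg : g ≠ 0) :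
    0 < V g c₀ sigma2 Sig 1 1 ↔ 0 < c₀ := by
  rw [V_eq hS hc _ rfl]
  have h := quadForm_pos hS.inv (SigTilde_inv_mulVec_ne_zero hS hc hg)
  have : (0 < sigma2 * (c₀ ^ 2 * (((SigTilde c₀ Sig)⁻¹ *ᵥ g) ⬝ᵥ
      Sig⁻¹ *ᵥ ((SigTilde c₀ Sig)⁻¹ *ᵥ g)))) ↔ 0 < c₀ := by
    constructor
    · intro h'
      refine lt_of_le_of_ne hc fun h0 => ?_
      simp [← h0] at h'
    · intro h'
      positivity
  simpa using this

/-- `Σ̃_xx` commutes with `Σ_xx`, so it preserves the eigenvectors of `Σ_xx`. -/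
lemma eigenvector_SigTilde_inv_iff (hS : Sig.PosDef) (hc : 0 ≤ c₀) (l : ℝ) :
    Sig *ᵥ ((SigTilde c₀ Sig)⁻¹ *ᵥ g) = l • ((SigTilde c₀ Sig)⁻¹ *ᵥ g) ↔ Sig *ᵥ g = l • g := by
  set h := (SigTilde c₀ Sig)⁻¹ *ᵥ g with hh
  have key : Sig *ᵥ h + c₀ • h = g := SigTilde_mulVec_inv hS hc
  constructor
  · intro e
    rw [← key, e, mulVec_add, mulVec_smul, mulVec_smul, e, smul_add, smul_comm c₀ l h]
  · intro e
    have hcomm : SigTilde c₀ Sig *ᵥ (Sig *ᵥ h) = SigTilde c₀ Sig *ᵥ (l • h) := by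
      have e1 : ∀ w, SigTilde c₀ Sig *ᵥ w = Sig *ᵥ w + c₀ • w := fun w => by
        rw [SigTilde, add_mulVec, smul_mulVec, one_mulVec]
      rw [e1, mulVec_smul, e1, key, ← e, ← key, mulVec_add, mulVec_smul]
    have hinj := congrArg (fun w => (SigTilde c₀ Sig)⁻¹ *ᵥ w) hcomm
    have hcancel : ∀ w, (SigTilde c₀ Sig)⁻¹ *ᵥ (SigTilde c₀ Sig *ᵥ w) = w := fun w => by
      rw [mulVec_mulVec, nonsing_inv_mul _ (isUnit_det_of_posDef (posDef_SigTilde hS hc)),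
        one_mulVec]
    simpa only [hcancel] using hinj

lemma V_posDef_iff (hS : Sig.PosDef) (hc : 0 ≤ c₀) (hs : 0 < sigma2) (hg : g ≠ 0) :
    (V g c₀ sigma2 Sig).PosDef ↔ 0 < c₀ ∧ ¬ ∃ l : ℝ, Sig *ᵥ g = l • g := by
  set h := (SigTilde c₀ Sig)⁻¹ *ᵥ g with hh
  have hu := isUnit_det_of_posDef hS
  have e1 : Sig *ᵥ (Sig⁻¹ *ᵥ h) = h := by
    rw [mulVec_mulVec, mul_nonsing_inv _ hu, one_mulVec]
  have hne : h ≠ 0 := SigTilde_inv_mulVec_ne_zero hS hc hg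
  constructor
  · intro hV
    have hc' : 0 < c₀ := (V_one_one_pos_iff hS hc hs hg).mp hV.diag_pos
    refine ⟨hc', ?_⟩
    rintro ⟨l, hl⟩
    rw [← eigenvector_SigTilde_inv_iff hS hc, ← hh] at hl
    have hl0 : l • (Sig⁻¹ *ᵥ h) = h := by
      rw [← mulVec_smul, ← hl, mulVec_mulVec, nonsing_inv_mul _ hu, one_mulVec]
    -- for an eigenvector, `Σ_xx⁻¹ h` is proportional to `h`, and `s = (c₀, l)` is degenerate
    have hs0 : (![c₀, l] : Fin 2 → ℝ) ≠ 0 := fun h0 => hc'.ne' (congrFun h0 0)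
    have hpos := hV.dotProduct_mulVec_pos hs0
    rw [star_trivial, V_quadForm hS hc h hh] at hpos
    simp [mul_smul, hl0] at hpos
  · rintro ⟨hc', hl⟩
    refine .of_dotProduct_mulVec_pos V_isHermitian fun s hs0 => ?_
    rw [star_trivial, V_quadForm hS hc h hh]
    refine mul_pos hs (quadForm_pos hS fun h0 => ?_)
    have h1 := congrArg (fun w => Sig *ᵥ w) h0
    simp only [mulVec_sub, mulVec_smul, e1, mulVec_zero, sub_eq_zero] at h1
    by_cases hs00 : s 0 = 0
    · rw [hs00, zero_smul] at h1
      rcases smul_eq_zero.mp h1.symm with h2 | h2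
      · have hs1 : s 1 = 0 := (mul_eq_zero.mp h2).resolve_left hc'.ne'
        exact hs0 (by ext i; fin_cases i <;> simp [hs00, hs1])
      · exact hne h2
    · refine hl ⟨(s 0)⁻¹ * (c₀ * s 1), (eigenvector_SigTilde_inv_iff hS hc _).mp ?_⟩
      rw [← hh, mul_smul, ← h1, smul_smul, inv_mul_cancel₀ hs00, one_smul]

/-- The variance of the difference `ξ₁ - ξ₂` is that of the least squares estimator. -/
lemma V_variance_sub (hS : Sig.PosDef) (hc : 0 ≤ c₀) :
    V g c₀ sigma2 Sig 0 0 + V g c₀ sigma2 Sig 1 1 - 2 * V g c₀ sigma2 Sig 0 1 =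
      sigma2 * (g ⬝ᵥ Sig⁻¹ *ᵥ g) := by
  set h := (SigTilde c₀ Sig)⁻¹ *ᵥ g with hh
  have hu := isUnit_det_of_posDef hS
  have key : Sig *ᵥ h + c₀ • h = g := SigTilde_mulVec_inv hS hc
  have e1 : Sig⁻¹ *ᵥ (Sig *ᵥ h) = h := by
    rw [mulVec_mulVec, nonsing_inv_mul _ hu, one_mulVec]
  have e2 : (Sig *ᵥ h) ⬝ᵥ (Sig⁻¹ *ᵥ h) = h ⬝ᵥ h := by
    rw [← dotProduct_mulVec_comm_of_transpose (transpose_of_posDef hS), mulVec_mulVec,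
      mul_nonsing_inv _ hu, one_mulVec]
  have e3 : (Sig *ᵥ h) ⬝ᵥ h = h ⬝ᵥ (Sig *ᵥ h) := dotProduct_comm _ _
  rw [V_eq hS hc h hh, ← key]
  simp only [mulVec_add, mulVec_smul, dotProduct_add, add_dotProduct, smul_dotProduct,
    dotProduct_smul, e1, e2, e3, smul_eq_mul]
  simp
  ring

lemma mSq_V (hS : Sig.PosDef) (hc : 0 ≤ c₀) (hs : 0 < sigma2) :
    mSq (V g c₀ sigma2 Sig) = (g ⬝ᵥ Sig⁻¹ *ᵥ g) /
      (g ⬝ᵥ ((SigTilde c₀ Sig)⁻¹ * Sig * (SigTilde c₀ Sig)⁻¹) *ᵥ g) := by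
  rw [mSq, V_variance_sub hS hc]
  have : V g c₀ sigma2 Sig 0 0 =
      sigma2 * (g ⬝ᵥ ((SigTilde c₀ Sig)⁻¹ * Sig * (SigTilde c₀ Sig)⁻¹) *ᵥ g) := by simp [V]
  rw [this, mul_div_mul_left _ _ hs.ne']

lemma tendsto_matrix_iff {ι m n : Type*} {l : Filter ι} {F : ι → Matrix m n ℝ}
    {A : Matrix m n ℝ} :
    Tendsto F l (𝓝 A) ↔ ∀ i j, Tendsto (fun k => F k i j) l (𝓝 (A i j)) := by
  refine (tendsto_pi_nhds (f := F) (g := A)).trans (forall_congr' fun i => ?_)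
  exact tendsto_pi_nhds (f := fun k => F k i) (g := A i)

lemma continuousAt_matrix_inv {A : Matrix (Fin p) (Fin p) ℝ} (hA : IsUnit A.det) :
    ContinuousAt (fun M : Matrix (Fin p) (Fin p) ℝ => M⁻¹) A := by
  have : (fun M : Matrix (Fin p) (Fin p) ℝ => M⁻¹) = fun M => (M.det)⁻¹ • M.adjugate := by
    ext1 M
    rw [inv_def, Ring.inverse_eq_inv']
  rw [this]
  have h1 : Continuous fun M : Matrix (Fin p) (Fin p) ℝ => M.det := continuous_id.matrix_det
  have h2 : Continuous fun M : Matrix (Fin p) (Fin p) ℝ => M.adjugate :=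
    continuous_id.matrix_adjugate
  exact (h1.continuousAt.inv₀ hA.ne_zero).smul h2.continuousAt

lemma continuousOn_V :
    ContinuousOn (fun q : ℝ × ℝ × Matrix (Fin p) (Fin p) ℝ => V g q.1 q.2.1 q.2.2)
      {q | 0 ≤ q.1 ∧ 0 < q.2.1 ∧ q.2.2.PosDef} := by
  rintro ⟨a, b, M⟩ ⟨ha, -, hM⟩
  refine ContinuousAt.continuousWithinAt ?_
  have hT : ContinuousAt
      (fun q : ℝ × ℝ × Matrix (Fin p) (Fin p) ℝ => (SigTilde q.1 q.2.2)⁻¹) (a, b, M) := by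
    refine ContinuousAt.comp (f := fun q : ℝ × ℝ × Matrix (Fin p) (Fin p) ℝ => SigTilde q.1 q.2.2)
      (continuousAt_matrix_inv (isUnit_det_of_posDef (posDef_SigTilde hM ha))) ?_
    unfold SigTilde
    fun_prop
  have hI : ContinuousAt (fun q : ℝ × ℝ × Matrix (Fin p) (Fin p) ℝ => q.2.2⁻¹) (a, b, M) :=
    ContinuousAt.comp (f := fun q : ℝ × ℝ × Matrix (Fin p) (Fin p) ℝ => q.2.2)
      (continuousAt_matrix_inv (isUnit_det_of_posDef hM)) (by fun_prop)
  have hd : ∀ F : ℝ × ℝ × Matrix (Fin p) (Fin p) ℝ → Matrix (Fin p) (Fin p) ℝ,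
      ContinuousAt F (a, b, M) → ContinuousAt (fun q => g ⬝ᵥ F q *ᵥ g) (a, b, M) := by
    intro F hF
    have : Continuous fun A : Matrix (Fin p) (Fin p) ℝ => g ⬝ᵥ A *ᵥ g :=
      continuous_const.dotProduct (continuous_id.matrix_mulVec continuous_const)
    exact ContinuousAt.comp (f := F) this.continuousAt hF
  have hm : ∀ F G : ℝ × ℝ × Matrix (Fin p) (Fin p) ℝ → Matrix (Fin p) (Fin p) ℝ,
      ContinuousAt F (a, b, M) → ContinuousAt G (a, b, M) →
      ContinuousAt (fun q => F q * G q) (a, b, M) := by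
    intro F G hF hG
    have : Continuous fun A : Matrix (Fin p) (Fin p) ℝ × Matrix (Fin p) (Fin p) ℝ => A.1 * A.2 :=
      continuous_fst.matrix_mul continuous_snd
    exact ContinuousAt.comp (f := fun q => (F q, G q)) this.continuousAt (hF.prodMk hG)
  have h1 := hd _ (hm _ _ (hm _ _ hT (continuous_snd.snd.continuousAt)) hT)
  have h2 := hd _ (hm _ _ hT hT)
  have h3 := hd _ (hm _ _ (hm _ _ hT hI) hT)
  have hc : ContinuousAt (fun q : ℝ × ℝ × Matrix (Fin p) (Fin p) ℝ => q.1) (a, b, M) :=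
    continuous_fst.continuousAt
  have hs : ContinuousAt (fun q : ℝ × ℝ × Matrix (Fin p) (Fin p) ℝ => q.2.1) (a, b, M) :=
    continuous_snd.fst.continuousAt
  rw [ContinuousAt, tendsto_matrix_iff]
  intro i j
  fin_cases i <;> fin_cases j <;> simp only [V, Matrix.smul_apply] <;>
    simp only [Fin.zero_eta, Fin.mk_one, Matrix.of_apply, Matrix.cons_val', Matrix.cons_val_zero,
      Matrix.cons_val_one, Matrix.cons_val_fin_one, smul_eq_mul]
  · exact hs.mul h1
  · exact hs.mul (hc.neg.mul h2)
  · exact hs.mul (hc.neg.mul h2)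
  · exact hs.mul ((hc.pow 2).mul h3)

end LinearAlgebra


/-! ### Characteristic functions of weighted sums -/

section CharFun

lemma norm_prod_sub_prod_le {ι : Type*} (s : Finset ι) (f g : ι → ℂ)
    (hf : ∀ i ∈ s, ‖f i‖ ≤ 1) (hg : ∀ i ∈ s, ‖g i‖ ≤ 1) :
    ‖∏ i ∈ s, f i - ∏ i ∈ s, g i‖ ≤ ∑ i ∈ s, ‖f i - g i‖ := by
  classical
  induction s using Finset.induction_on with
  | empty => simp
  | insert a s ha ih =>
    rw [Finset.prod_insert ha, Finset.prod_insert ha, Finset.sum_insert ha]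
    have hfs : ‖∏ i ∈ s, f i‖ ≤ 1 := by
      rw [norm_prod]
      exact Finset.prod_le_one (fun _ _ => norm_nonneg _)
        fun i hi => hf i (Finset.mem_insert_of_mem hi)
    have hih := ih (fun i hi => hf i (Finset.mem_insert_of_mem hi))
      (fun i hi => hg i (Finset.mem_insert_of_mem hi))
    calc ‖f a * ∏ i ∈ s, f i - g a * ∏ i ∈ s, g i‖
        = ‖(f a - g a) * ∏ i ∈ s, f i + g a * (∏ i ∈ s, f i - ∏ i ∈ s, g i)‖ := by ring_nf
      _ ≤ ‖f a - g a‖ * ‖∏ i ∈ s, f i‖ + ‖g a‖ * ‖∏ i ∈ s, f i - ∏ i ∈ s, g i‖ := by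
          refine (norm_add_le _ _).trans ?_
          rw [norm_mul, norm_mul]
      _ ≤ ‖f a - g a‖ * 1 + 1 * ∑ i ∈ s, ‖f i - g i‖ := by
          gcongr
          exact hg a (Finset.mem_insert_self _ _)
      _ = _ := by ring

lemma norm_exp_neg_ofReal_le_one {r : ℝ} (hr : 0 ≤ r) : ‖Complex.exp (-(r : ℂ))‖ ≤ 1 := by
  rw [Complex.norm_exp]
  simpa using hr

/-- For a centered law with finite variance, the characteristic function agrees to second order
with that of the Gaussian of the same variance. -/
lemma charFun_sub_exp_isLittleO {Ω : Type*} [MeasurableSpace Ω] {P : Measure Ω}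
    [IsProbabilityMeasure P] {X : Ω → ℝ} (hX : MemLp X 2 P) (h0 : ∫ ω, X ω ∂P = 0) {v : ℝ}
    (hv : ∫ ω, X ω ^ 2 ∂P = v) :
    (fun u : ℝ => charFun (P.map X) u - Complex.exp (-((v * u ^ 2 / 2 : ℝ) : ℂ)))
      =o[𝓝 0] fun u : ℝ => u ^ 2 := by
  have hXm : AEMeasurable X P := hX.aestronglyMeasurable.aemeasurable
  have hid : MemLp id 2 (P.map X) :=
    (memLp_map_measure_iff aestronglyMeasurable_id hXm).mpr (by simpa using hX)
  have : IsProbabilityMeasure (P.map X) := Measure.isProbabilityMeasure_map hXm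
  have h1 : (fun u : ℝ => charFun (P.map X) u - (1 - ((v * u ^ 2 / 2 : ℝ) : ℂ)))
      =o[𝓝 0] fun u : ℝ => u ^ 2 := by
    have ht := taylor_isLittleO_univ (f := charFun (P.map X)) (x₀ := 0) (n := 2)
      (contDiff_charFun (by simpa using hid))
    simp only [sub_zero] at ht
    refine ht.congr_left fun u => ?_
    rw [taylorWithinEval_charFun_two_zero hXm hid]
    simp only [Pi.pow_apply, h0, hv]
    push_cast
    ring
  have h2 : (fun u : ℝ =>
      Complex.exp (-((v * u ^ 2 / 2 : ℝ) : ℂ)) - (1 - ((v * u ^ 2 / 2 : ℝ) : ℂ)))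
      =o[𝓝 0] fun u : ℝ => u ^ 2 := by
    have hlim : Tendsto (fun u : ℝ => v * u ^ 2 / 2) (𝓝 0) (𝓝 0) := by
      have : Continuous fun u : ℝ => v * u ^ 2 / 2 := by fun_prop
      simpa using this.tendsto 0
    have hO : (fun u : ℝ => Complex.exp (-((v * u ^ 2 / 2 : ℝ) : ℂ))
        - (1 - ((v * u ^ 2 / 2 : ℝ) : ℂ))) =O[𝓝 0] fun u : ℝ => (v * u ^ 2 / 2) ^ 2 := by
      refine IsBigO.of_bound 1 ?_
      have hev : ∀ᶠ u : ℝ in 𝓝 0, |v * u ^ 2 / 2| ≤ 1 := by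
        have := hlim.abs
        simp only [abs_zero] at this
        exact this.eventually_le_const one_pos
      filter_upwards [hev] with u hu
      have := Complex.norm_exp_sub_one_sub_id_le (x := -((v * u ^ 2 / 2 : ℝ) : ℂ))
        (by rw [norm_neg, Complex.norm_real]; exact hu)
      rw [norm_neg, Complex.norm_real] at this
      rw [norm_pow, one_mul]
      refine le_trans (le_of_eq ?_) this
      congr 1
      ring
    refine hO.trans_isLittleO ?_
    have h3 : (fun u : ℝ => (v * u ^ 2 / 2) * (v * u ^ 2 / 2)) =o[𝓝 0]
        fun u : ℝ => (1 : ℝ) * u ^ 2 := by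
      refine IsLittleO.mul_isBigO ((isLittleO_one_iff ℝ).mpr hlim) ?_
      refine IsBigO.of_bound (|v| / 2) (Eventually.of_forall fun u => le_of_eq ?_)
      simp
      ring
    simpa [sq] using h3
  refine (h1.sub h2).congr_left fun u => ?_
  ring

/-- Convergence of the characteristic function of a weighted sum with uniformly negligible
weights, for a law `μ` which matches the Gaussian to second order. -/
lemma tendsto_prod_charFun {μ : Measure ℝ} [IsProbabilityMeasure μ] {v w : ℝ} (hv : 0 ≤ v)
    (hμ : (fun u : ℝ => charFun μ u - Complex.exp (-((v * u ^ 2 / 2 : ℝ) : ℂ)))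
      =o[𝓝 0] fun u : ℝ => u ^ 2)
    {a : ∀ n : ℕ, Fin n → ℝ} (hmax : ∀ η > 0, ∀ᶠ n in atTop, ∀ t, |a n t| < η)
    (hsum : Tendsto (fun n => ∑ t, a n t ^ 2) atTop (𝓝 w)) :
    Tendsto (fun n => ∏ t, charFun μ (a n t)) atTop
      (𝓝 (Complex.exp (-((v * w / 2 : ℝ) : ℂ)))) := by
  have hexp : Tendsto (fun n => ∏ t, Complex.exp (-((v * a n t ^ 2 / 2 : ℝ) : ℂ))) atTop
      (𝓝 (Complex.exp (-((v * w / 2 : ℝ) : ℂ)))) := by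
    have h1 : (fun n => ∏ t, Complex.exp (-((v * a n t ^ 2 / 2 : ℝ) : ℂ))) =
        fun n => Complex.exp (-((v * (∑ t, a n t ^ 2) / 2 : ℝ) : ℂ)) := by
      funext n
      rw [← Complex.exp_sum, Finset.mul_sum, Finset.sum_div, Finset.sum_neg_distrib]
      push_cast
      rfl
    rw [h1]
    have : Continuous fun y : ℝ => Complex.exp (-((v * y / 2 : ℝ) : ℂ)) := by fun_prop
    exact (this.tendsto w).comp hsum
  refine hexp.congr_dist ?_
  rw [Metric.tendsto_nhds]
  intro η hη
  have hw : 0 ≤ w := ge_of_tendsto hsum (Eventually.of_forall fun n =>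
    Finset.sum_nonneg fun t _ => sq_nonneg _)
  have hη' : 0 < η / (w + 2) := by positivity
  obtain ⟨r, hr, hball⟩ := Metric.eventually_nhds_iff.mp (hμ.bound hη')
  filter_upwards [hmax r hr, hsum.eventually_lt_const (lt_add_one w)] with n hn hn2
  rw [Real.dist_eq, sub_zero, abs_of_nonneg dist_nonneg, dist_comm, dist_eq_norm]
  calc _ ≤ ∑ t, ‖charFun μ (a n t) - Complex.exp (-((v * a n t ^ 2 / 2 : ℝ) : ℂ))‖ :=
        norm_prod_sub_prod_le _ _ _ (fun _ _ => norm_charFun_le_one _)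
          fun t _ => norm_exp_neg_ofReal_le_one (by positivity)
    _ ≤ ∑ t, η / (w + 2) * a n t ^ 2 := by
        refine Finset.sum_le_sum fun t _ => ?_
        have := hball (y := a n t) (by simpa using hn t)
        simpa using this
    _ = η / (w + 2) * ∑ t, a n t ^ 2 := by rw [Finset.mul_sum]
    _ ≤ η / (w + 2) * (w + 1) := by gcongr
    _ < η := by
        rw [div_mul_eq_mul_div, div_lt_iff₀ (by positivity)]
        nlinarith

lemma charFun_map_sum_mul {Ω : Type*} [MeasurableSpace Ω] {P : Measure Ω}
    [IsProbabilityMeasure P] {ε : ℕ → Ω → ℝ} (hm : ∀ t, Measurable (ε t)) (hi : iIndepFun ε P)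
    (hd : ∀ t, IdentDistrib (ε t) (ε 0) P P) {n : ℕ} (a : Fin n → ℝ) (s : ℝ) :
    charFun (P.map fun ω => ∑ t : Fin n, a t * ε t ω) s = ∏ t, charFun (P.map (ε 0)) (a t * s) := by
  have hi' : iIndepFun (fun (t : Fin n) ω => a t * ε t ω) P :=
    (hi.precomp Fin.val_injective).comp (fun (t : Fin n) y => a t * y) (by fun_prop)
  have h := hi'.charFun_map_fun_sum_eq_prod
    fun t : Fin n => ((hm t).const_mul (a t)).aemeasurable
  rw [h, Finset.prod_apply]
  refine Finset.prod_congr rfl fun t _ => ?_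
  rw [charFun_map_mul_comp (hm t).aemeasurable, (hd t).map_eq]

end CharFun


/-! ### Limits in probability as limits along a filter -/

section ProbFilter

variable {ι : Type*} {l : Filter ι} {Ω : ι → Type*} [∀ i, MeasurableSpace (Ω i)]
  {μ : ∀ i, Measure (Ω i)}

/-- The filter of events of asymptotic probability one, for a family of measures `μ i` along `l`:
a set of pairs `(i, ω)` belongs to it if the `μ i`-measure of the complement of its slice at `i`
tends to zero. For probability measures, a limit along this filter is a limit in probability, so
that the `o_P(1)` calculus becomes the calculus of limits along a filter. -/
def probFilter (l : Filter ι) (μ : ∀ i, Measure (Ω i)) : Filter (Σ i, Ω i) where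
  sets := {S | Tendsto (fun i => μ i {ω | (⟨i, ω⟩ : Σ i, Ω i) ∉ S}) l (𝓝 0)}
  univ_sets := by simpa using tendsto_const_nhds
  sets_of_superset := by
    intro S T hS hST
    exact tendsto_of_tendsto_of_tendsto_of_le_of_le tendsto_const_nhds hS
      (fun _ => zero_le) fun i => measure_mono fun ω hω h => hω (hST h)
  inter_sets := by
    intro S T hS hT
    refine tendsto_of_tendsto_of_tendsto_of_le_of_le tendsto_const_nhds
      (by simpa using Tendsto.add hS hT) (fun _ => zero_le) fun i => ?_
    refine (measure_mono fun ω hω => ?_).trans (measure_union_le _ _)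
    by_contra h
    simp only [Set.mem_union, Set.mem_ofPred_eq, not_or, not_not] at h
    exact hω ⟨h.1, h.2⟩

lemma mem_probFilter {S : Set (Σ i, Ω i)} :
    S ∈ probFilter l μ ↔ Tendsto (fun i => μ i {ω | (⟨i, ω⟩ : Σ i, Ω i) ∉ S}) l (𝓝 0) := Iff.rfl

lemma tendsto_fst_probFilter : Tendsto Sigma.fst (probFilter l μ) l := by
  intro U hU
  rw [Filter.mem_map, mem_probFilter]
  refine tendsto_const_nhds.congr' ?_
  filter_upwards [hU] with i hi
  simp [hi]

lemma tendsto_probFilter_iff {E : Type*} [PseudoMetricSpace E] {f : (Σ i, Ω i) → E} {a : E} :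
    Tendsto f (probFilter l μ) (𝓝 a) ↔
      ∀ η > 0, Tendsto (fun i => μ i {ω | η ≤ dist (f ⟨i, ω⟩) a}) l (𝓝 0) := by
  rw [Metric.tendsto_nhds]
  refine forall₂_congr fun η hη => ?_
  rw [Filter.Eventually, mem_probFilter]
  simp only [Set.mem_ofPred_eq, not_lt]

lemma tendstoInMeasure_iff_tendsto_probFilter {Ω₀ E : Type*} [MeasurableSpace Ω₀]
    {P : Measure Ω₀} [PseudoMetricSpace E] {f : ι → Ω₀ → E} {a : E} :
    TendstoInMeasure P f l (fun _ => a) ↔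
      Tendsto (fun z : Σ _ : ι, Ω₀ => f z.1 z.2) (probFilter l fun _ => P) (𝓝 a) := by
  rw [tendsto_probFilter_iff, tendstoInMeasure_iff_dist]

variable [∀ i, IsProbabilityMeasure (μ i)]

lemma tendsto_probFilter_iff_real {E : Type*} [PseudoMetricSpace E] {f : (Σ i, Ω i) → E} {a : E} :
    Tendsto f (probFilter l μ) (𝓝 a) ↔
      ∀ η > 0, Tendsto (fun i => (μ i).real {ω | η ≤ dist (f ⟨i, ω⟩) a}) l (𝓝 0) := by
  rw [tendsto_probFilter_iff]
  refine forall₂_congr fun η hη => ?_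
  rw [← ENNReal.tendsto_toReal_iff (fun i => measure_ne_top _ _) ENNReal.zero_ne_top]
  rfl

/-- Convergence of expectations to zero implies convergence to zero in probability. -/
lemma tendsto_probFilter_of_integral {f : (Σ i, Ω i) → ℝ} (h0 : ∀ z, 0 ≤ f z)
    (hi : ∀ᶠ i in l, Integrable (fun ω => f ⟨i, ω⟩) (μ i))
    (hlim : Tendsto (fun i => ∫ ω, f ⟨i, ω⟩ ∂μ i) l (𝓝 0)) :
    Tendsto f (probFilter l μ) (𝓝 0) := by
  rw [tendsto_probFilter_iff_real]
  intro η hη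
  have hlim' : Tendsto (fun i => (∫ ω, f ⟨i, ω⟩ ∂μ i) / η) l (𝓝 0) := by
    simpa using hlim.div_const η
  refine tendsto_of_tendsto_of_tendsto_of_le_of_le' tendsto_const_nhds hlim'
    (Eventually.of_forall fun _ => measureReal_nonneg) ?_
  filter_upwards [hi] with i hi
  rw [le_div_iff₀ hη, mul_comm]
  have := mul_meas_ge_le_integral_of_nonneg (Eventually.of_forall fun ω => h0 ⟨i, ω⟩) hi η
  simpa [abs_of_nonneg (h0 _)] using this

lemma tendsto_probFilter_of_integral_sq {f : (Σ i, Ω i) → ℝ}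
    (hi : ∀ᶠ i in l, Integrable (fun ω => f ⟨i, ω⟩ ^ 2) (μ i))
    (hlim : Tendsto (fun i => ∫ ω, f ⟨i, ω⟩ ^ 2 ∂μ i) l (𝓝 0)) :
    Tendsto f (probFilter l μ) (𝓝 0) := by
  have h := tendsto_probFilter_of_integral (f := fun z => f z ^ 2) (fun z => sq_nonneg _) hi hlim
  have h2 := (Real.continuous_sqrt.tendsto 0).comp h
  simp only [Function.comp_def, Real.sqrt_sq_eq_abs, Real.sqrt_zero] at h2
  exact (tendsto_zero_iff_abs_tendsto_zero _).mpr h2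

/-- The product of a sequence tending to zero in probability and of a sequence bounded in `L²`
tends to zero in probability. -/
lemma tendsto_probFilter_mul_of_integral_sq_le {X W : (Σ i, Ω i) → ℝ} {C : ℝ}
    (hX : Tendsto X (probFilter l μ) (𝓝 0))
    (hi : ∀ᶠ i in l, Integrable (fun ω => W ⟨i, ω⟩ ^ 2) (μ i))
    (hC : ∀ᶠ i in l, ∫ ω, W ⟨i, ω⟩ ^ 2 ∂μ i ≤ C) :
    Tendsto (fun z => X z * W z) (probFilter l μ) (𝓝 0) := by
  rw [tendsto_probFilter_iff_real]
  intro η hη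
  rw [Metric.tendsto_nhds]
  intro κ hκ
  obtain ⟨ρ, hρ, hρC⟩ : ∃ ρ > 0, |C| * ρ ^ 2 / η ^ 2 < κ / 2 := by
    have hcont : Continuous fun ρ : ℝ => |C| * ρ ^ 2 / η ^ 2 := by fun_prop
    have h0 : Tendsto (fun ρ : ℝ => |C| * ρ ^ 2 / η ^ 2) (𝓝[>] 0) (𝓝 0) := by
      have := (hcont.tendsto 0).mono_left (nhdsWithin_le_nhds (s := Set.Ioi 0))
      simpa using this
    obtain ⟨ρ, h1, h2⟩ :=
      ((h0.eventually_lt_const (half_pos hκ)).and self_mem_nhdsWithin).exists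
    exact ⟨ρ, h2, h1⟩
  have hXρ := tendsto_probFilter_iff_real.mp hX ρ hρ
  filter_upwards [hi, hC, hXρ.eventually_lt_const (half_pos hκ)] with i hi hC hXi
  rw [Real.dist_eq, sub_zero, abs_of_nonneg measureReal_nonneg]
  have hsub : {ω | η ≤ dist (X ⟨i, ω⟩ * W ⟨i, ω⟩) 0} ⊆
      {ω | ρ ≤ dist (X ⟨i, ω⟩) 0} ∪ {ω | (η / ρ) ^ 2 ≤ W ⟨i, ω⟩ ^ 2} := by
    intro ω hω
    simp only [Set.mem_ofPred_eq, Set.mem_union, Real.dist_eq, sub_zero] at hω ⊢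
    by_contra hcon
    simp only [not_or, not_le] at hcon
    obtain ⟨h1, h2⟩ := hcon
    rw [sq_lt_sq, abs_of_pos (div_pos hη hρ), lt_div_iff₀ hρ] at h2
    rw [abs_mul] at hω
    nlinarith [abs_nonneg (W ⟨i, ω⟩), abs_nonneg (X ⟨i, ω⟩)]
  have hM := mul_meas_ge_le_integral_of_nonneg
    (Eventually.of_forall fun ω => sq_nonneg (W ⟨i, ω⟩)) hi ((η / ρ) ^ 2)
  have hM2 : (μ i).real {ω | (η / ρ) ^ 2 ≤ W ⟨i, ω⟩ ^ 2} ≤ |C| * ρ ^ 2 / η ^ 2 := by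
    rw [le_div_iff₀ (by positivity)]
    have h3 := (hM.trans hC).trans (le_abs_self C)
    rw [div_pow, div_mul_eq_mul_div, div_le_iff₀ (by positivity), ← div_pow] at h3
    linarith
  calc _ ≤ _ := measureReal_mono hsub
    _ ≤ _ := measureReal_union_le _ _
    _ < κ / 2 + κ / 2 := add_lt_add_of_lt_of_le hXi (hM2.trans hρC.le)
    _ = κ := by ring

/-- Slutsky's theorem for characteristic functions, on varying probability spaces. -/
lemma tendsto_charFun_of_tendsto_sub {X Y : (Σ i, Ω i) → ℝ} {s : ℝ} {φ : ℂ}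
    (hX : ∀ i, Measurable fun ω => X ⟨i, ω⟩) (hY : ∀ i, Measurable fun ω => Y ⟨i, ω⟩)
    (hXφ : Tendsto (fun i => charFun ((μ i).map fun ω => X ⟨i, ω⟩) s) l (𝓝 φ))
    (hXY : Tendsto (fun z => Y z - X z) (probFilter l μ) (𝓝 0)) :
    Tendsto (fun i => charFun ((μ i).map fun ω => Y ⟨i, ω⟩) s) l (𝓝 φ) := by
  refine hXφ.congr_dist ?_
  rw [Metric.tendsto_nhds]
  intro κ hκ
  set η := κ / (4 * (|s| + 1)) with hη
  have hη0 : 0 < η := by positivity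
  have hsη : |s| * η ≤ κ / 4 := by
    rw [hη, mul_div_assoc', div_le_div_iff₀ (by positivity) (by positivity)]
    nlinarith [abs_nonneg s]
  have hlim := tendsto_probFilter_iff_real.mp hXY η hη0
  filter_upwards [hlim.eventually_lt_const (show 0 < κ / 4 by positivity)] with i hi
  rw [Real.dist_eq, sub_zero, abs_of_nonneg dist_nonneg, dist_comm, dist_eq_norm]
  set A : Set (Ω i) := {ω | η ≤ dist (Y ⟨i, ω⟩ - X ⟨i, ω⟩) 0} with hA
  have hAm : MeasurableSet A := measurableSet_le measurable_const
    (((hY i).sub (hX i)).dist measurable_const)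
  have hint : ∀ Z : Ω i → ℝ, Measurable Z →
      Integrable (fun ω => Complex.exp (s * Z ω * Complex.I)) (μ i) := by
    intro Z hZ
    refine Integrable.of_bound (by fun_prop) 1 (Eventually.of_forall fun ω => ?_)
    rw [← Complex.ofReal_mul, Complex.norm_exp_ofReal_mul_I]
  have hcf : ∀ Z : Ω i → ℝ, Measurable Z →
      charFun ((μ i).map Z) s = ∫ ω, Complex.exp (s * Z ω * Complex.I) ∂μ i := by
    intro Z hZ
    rw [charFun_apply_real, integral_map hZ.aemeasurable (by fun_prop)]
  rw [hcf _ (hX i), hcf _ (hY i), ← integral_sub (hint _ (hY i)) (hint _ (hX i))]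
  have hpt : ∀ ω, ‖Complex.exp (s * Y ⟨i, ω⟩ * Complex.I)
      - Complex.exp (s * X ⟨i, ω⟩ * Complex.I)‖ ≤ κ / 4 + A.indicator (fun _ => 2) ω := by
    intro ω
    by_cases hω : ω ∈ A
    · rw [Set.indicator_of_mem hω]
      refine (norm_sub_le _ _).trans ?_
      rw [← Complex.ofReal_mul, Complex.norm_exp_ofReal_mul_I, ← Complex.ofReal_mul,
        Complex.norm_exp_ofReal_mul_I]
      linarith
    · rw [Set.indicator_of_notMem hω, add_zero]
      have hfac : Complex.exp (s * Y ⟨i, ω⟩ * Complex.I) - Complex.exp (s * X ⟨i, ω⟩ * Complex.I)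
          = Complex.exp ((s * X ⟨i, ω⟩ : ℝ) * Complex.I) *
            (Complex.exp (Complex.I * (s * (Y ⟨i, ω⟩ - X ⟨i, ω⟩) : ℝ)) - 1) := by
        rw [mul_sub, ← Complex.exp_add, mul_one]
        push_cast
        congr 2
        ring
      rw [hfac, norm_mul, Complex.norm_exp_ofReal_mul_I, one_mul]
      refine Real.norm_exp_I_mul_ofReal_sub_one_le.trans ?_
      simp only [hA, Set.mem_ofPred_eq, not_le, Real.dist_eq, sub_zero] at hω
      rw [norm_mul, Real.norm_eq_abs, Real.norm_eq_abs]
      exact (mul_le_mul_of_nonneg_left hω.le (abs_nonneg s)).trans hsη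
  have hAi : Integrable (A.indicator fun _ => (2 : ℝ)) (μ i) :=
    (integrable_const _).indicator hAm
  calc _ ≤ ∫ ω, (κ / 4 + A.indicator (fun _ => 2) ω) ∂μ i :=
        norm_integral_le_of_norm_le ((integrable_const _).add hAi) (Eventually.of_forall hpt)
    _ = κ / 4 + (μ i).real A * 2 := by
        rw [integral_add (integrable_const _) hAi, integral_indicator_const _ hAm]
        simp
    _ < κ := by linarith

end ProbFilter

/-- Limits in probability can be deduced from a deterministic implication: if `F` converges along
every sequence of outcomes along which a statistic `Q` converges to `q`, and `Q` converges to `q`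
in probability, then `F` converges in probability. -/
lemma tendsto_probFilter_of_seq {Ω E : Type*} [MeasurableSpace Ω] {P : Measure Ω}
    [TopologicalSpace E] [FirstCountableTopology E] {Q : (Σ _ : ℕ, Ω) → E} {q : E}
    {F : (Σ _ : ℕ, Ω) → ℝ} {b : ℝ} (hQ : Tendsto Q (probFilter atTop fun _ => P) (𝓝 q))
    (h : ∀ z : ℕ → Σ _ : ℕ, Ω, Tendsto (fun k => (z k).1) atTop atTop →
      Tendsto (fun k => Q (z k)) atTop (𝓝 q) → Tendsto (fun k => F (z k)) atTop (𝓝 b)) :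
    Tendsto F (probFilter atTop fun _ => P) (𝓝 b) := by
  have hle : (probFilter atTop fun _ => P) ≤ comap Sigma.fst atTop ⊓ comap Q (𝓝 q) :=
    le_inf (tendsto_iff_comap.mp tendsto_fst_probFilter) (tendsto_iff_comap.mp hQ)
  refine Tendsto.mono_left ?_ hle
  refine tendsto_of_seq_tendsto fun z hz => ?_
  rw [tendsto_inf, tendsto_comap_iff, tendsto_comap_iff] at hz
  exact h z hz.1 hz.2

/-- Convergence of characteristic functions to that of a nondegenerate centered Gaussian implies
convergence of distribution functions. -/
lemma tendsto_measureReal_Iic_of_charFun {μ : ℕ → Measure ℝ} [∀ k, IsProbabilityMeasure (μ k)]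
    {v : NNReal} (hv : v ≠ 0)
    (h : ∀ s : ℝ, Tendsto (fun k => charFun (μ k) s) atTop
      (𝓝 (Complex.exp (-((v * s ^ 2 / 2 : ℝ) : ℂ))))) (u : ℝ) :
    Tendsto (fun k => (μ k).real (Set.Iic u)) atTop
      (𝓝 ((gaussianReal 0 v).real (Set.Iic u))) := by
  have := nullSingletonClass_gaussianReal (μ := 0) hv
  let ν : ProbabilityMeasure ℝ := ⟨gaussianReal 0 v, inferInstance⟩
  let μ' : ℕ → ProbabilityMeasure ℝ := fun k => ⟨μ k, inferInstance⟩
  have hconv : Tendsto μ' atTop (𝓝 ν) := by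
    refine ProbabilityMeasure.tendsto_of_tendsto_charFun fun s => ?_
    have hν : charFun (ν : Measure ℝ) s = Complex.exp (-((v * s ^ 2 / 2 : ℝ) : ℂ)) := by
      change charFun (gaussianReal 0 v) s = _
      rw [charFun_gaussianReal]
      congr 1
      push_cast
      ring
    rw [hν]
    exact h s
  have hfr := ProbabilityMeasure.tendsto_measure_of_null_frontier_of_tendsto' hconv
    (E := Set.Iic u) (by simp [ν])
  exact (ENNReal.tendsto_toReal (measure_ne_top _ _)).comp hfr


/-! ### Sums of uniform draws from a finite sample -/

section PairsLaw

instance isProbabilityMeasure_uniformOn_univ_fin (n : ℕ) [NeZero n] :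
    IsProbabilityMeasure (uniformOn (Set.univ : Set (Fin n))) :=
  isProbabilityMeasure_uniformOn Set.finite_univ ⟨0, trivial⟩

/-- For `n = 0` there is exactly one resample, the empty one. -/
instance isProbabilityMeasure_pairsLaw (n : ℕ) : IsProbabilityMeasure (pairsLaw n) := by
  rcases Nat.eq_zero_or_pos n with rfl | hn
  · rw [pairsLaw, Measure.pi_of_empty]
    infer_instance
  · have : NeZero n := ⟨hn.ne'⟩
    rw [pairsLaw]
    infer_instance

lemma integral_uniformOn_univ_fin {n : ℕ} [NeZero n] {E : Type*} [NormedAddCommGroup E]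
    [NormedSpace ℝ E] [CompleteSpace E] (f : Fin n → E) :
    ∫ i, f i ∂(uniformOn (Set.univ : Set (Fin n))) = (n : ℝ)⁻¹ • ∑ i, f i := by
  rw [integral_fintype (Integrable.of_finite), Finset.smul_sum]
  refine Finset.sum_congr rfl fun i _ => ?_
  congr 1
  rw [measureReal_def, uniformOn_univ, Measure.count_singleton]
  simp

/-- Second moment of a sum of independent uniform draws from centered values. -/
lemma integral_sum_sq_pairsLaw {n : ℕ} [NeZero n] (f : Fin n → ℝ) (hf : ∑ i, f i = 0) :
    ∫ j, (∑ t, f (j t)) ^ 2 ∂(pairsLaw n) = ∑ i, f i ^ 2 := by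
  have hn : (n : ℝ) ≠ 0 := Nat.cast_ne_zero.mpr (NeZero.ne n)
  have hmean : ∀ t, ∫ j, f (j t) ∂(pairsLaw n) = 0 := by
    intro t
    rw [pairsLaw, integral_comp_eval (μ := fun _ : Fin n => uniformOn (Set.univ : Set (Fin n)))
      (i := t) (f := f) (Measurable.of_discrete).aestronglyMeasurable,
      integral_uniformOn_univ_fin, hf, smul_zero]
  have hvar := variance_sum_pi (μ := fun _ : Fin n => uniformOn (Set.univ : Set (Fin n)))
    (X := fun _ => f) fun _ => MemLp.of_discrete
  have hf0 : ∫ i, f i ∂(uniformOn (Set.univ : Set (Fin n))) = 0 := by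
    rw [integral_uniformOn_univ_fin, hf, smul_zero]
  have hsum : (∑ i, fun ω : Fin n → Fin n => f (ω i)) = fun j => ∑ t, f (j t) := by
    ext j
    simp
  rw [hsum, variance_of_integral_eq_zero (Measurable.of_discrete).aemeasurable,
    Finset.sum_congr rfl fun i _ => variance_of_integral_eq_zero
      (Measurable.of_discrete).aemeasurable hf0] at hvar
  · rw [pairsLaw]
    rw [hvar]
    simp [integral_uniformOn_univ_fin, hn]
  · rw [integral_finsetSum _ fun _ _ => Integrable.of_finite]
    exact Finset.sum_eq_zero fun t _ => hmean t

lemma charFun_pairsLaw {n : ℕ} [NeZero n] (z : Fin n → ℝ) (s : ℝ) :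
    charFun ((pairsLaw n).map fun j => (√(n : ℝ))⁻¹ * ∑ t, z (j t)) s =
      ((n : ℂ)⁻¹ * ∑ i, Complex.exp (((s * (√(n : ℝ))⁻¹ * z i : ℝ) : ℂ) * Complex.I)) ^ n := by
  rw [charFun_apply_real, integral_map (Measurable.of_discrete).aemeasurable (by fun_prop)]
  have h := integral_fintype_prod_eq_prod (μ := fun _ : Fin n => uniformOn (Set.univ : Set (Fin n)))
    (fun (_ : Fin n) (i : Fin n) =>
      Complex.exp (((s * (√(n : ℝ))⁻¹ * z i : ℝ) : ℂ) * Complex.I))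
  rw [Finset.prod_const, Finset.card_univ, Fintype.card_fin, integral_uniformOn_univ_fin] at h
  rw [← Complex.coe_smul, smul_eq_mul, Complex.ofReal_inv, Complex.ofReal_natCast] at h
  rw [← h, pairsLaw]
  congr 1
  ext j
  rw [← Complex.exp_sum]
  congr 1
  push_cast
  rw [← Finset.sum_mul, ← Finset.mul_sum]
  ring

/-- Second-order Taylor bound for `exp (i a)`; the constant `3` bounds `e`. -/
lemma norm_exp_mul_I_sub_le {a : ℝ} (ha : |a| ≤ 1) :
    ‖Complex.exp ((a : ℂ) * Complex.I) - 1 - (a : ℂ) * Complex.I + (a : ℂ) ^ 2 / 2‖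
      ≤ 3 * |a| ^ 3 := by
  have h := Complex.norm_exp_sub_sum_le_norm_mul_exp ((a : ℂ) * Complex.I) 3
  rw [norm_mul, Complex.norm_I, mul_one, Complex.norm_real, Real.norm_eq_abs] at h
  have hexp : Real.exp |a| ≤ 3 := by
    refine (Real.exp_le_exp.mpr ha).trans ?_
    exact Real.exp_one_lt_three.le
  have heq : Complex.exp ((a : ℂ) * Complex.I) - 1 - (a : ℂ) * Complex.I + (a : ℂ) ^ 2 / 2 =
      Complex.exp ((a : ℂ) * Complex.I)
        - ∑ m ∈ Finset.range 3, ((a : ℂ) * Complex.I) ^ m / (m.factorial : ℂ) := by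
    simp [Finset.sum_range_succ, mul_pow]
    ring
  rw [heq]
  refine h.trans ?_
  rw [mul_comm 3]
  gcongr

/-- Central limit theorem for the bootstrap: the characteristic function of the normalized sum of
`n` independent uniform draws from centered values `z`, whose second moments converge and whose
fourth moments are negligible, converges to that of the Gaussian. -/
lemma tendsto_charFun_pairsLaw {N : ℕ → ℕ} (hN : Tendsto N atTop atTop)
    {z : ∀ k, Fin (N k) → ℝ} (hz : ∀ᶠ k in atTop, ∑ i, z k i = 0) {v : ℝ}
    (h2 : Tendsto (fun k => (N k : ℝ)⁻¹ * ∑ i, z k i ^ 2) atTop (𝓝 v))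
    (h4 : Tendsto (fun k => ((N k : ℝ) ^ 2)⁻¹ * ∑ i, z k i ^ 4) atTop (𝓝 0)) (s : ℝ) :
    Tendsto (fun k => charFun ((pairsLaw (N k)).map
      fun j => (√(N k : ℝ))⁻¹ * ∑ t, z k (j t)) s) atTop
      (𝓝 (Complex.exp (-((v * s ^ 2 / 2 : ℝ) : ℂ)))) := by
  set q : ℕ → ℝ := fun k => s ^ 2 * ((N k : ℝ)⁻¹ * ∑ i, z k i ^ 2) / 2 with hq
  set M : ℕ → ℝ := fun k => √√(s ^ 4 * (((N k : ℝ) ^ 2)⁻¹ * ∑ i, z k i ^ 4)) with hM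
  have hqlim : Tendsto q atTop (𝓝 (v * s ^ 2 / 2)) := by
    have := (h2.const_mul (s ^ 2)).div_const 2
    rwa [mul_comm (s ^ 2) v] at this
  have hMlim : Tendsto M atTop (𝓝 0) := by
    have h := h4.const_mul (s ^ 4)
    have hc : Continuous fun y : ℝ => √√y := by fun_prop
    have h0 := (hc.tendsto (s ^ 4 * 0)).comp h
    simp only [mul_zero, Real.sqrt_zero] at h0
    exact h0
  have hNr : Tendsto (fun k => ((N k : ℝ))⁻¹) atTop (𝓝 0) :=
    tendsto_inv_atTop_zero.comp (tendsto_natCast_atTop_atTop.comp hN)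
  have hexp : Tendsto (fun k => Complex.exp (-((q k : ℝ) : ℂ))) atTop
      (𝓝 (Complex.exp (-((v * s ^ 2 / 2 : ℝ) : ℂ)))) := by
    have : Continuous fun y : ℝ => Complex.exp (-(y : ℂ)) := by fun_prop
    exact (this.tendsto _).comp hqlim
  refine hexp.congr_dist ?_
  have hb : Tendsto (fun k => 3 * M k * (2 * q k) + q k ^ 2 * (N k : ℝ)⁻¹) atTop (𝓝 0) := by
    have := ((hMlim.const_mul 3).mul (hqlim.const_mul 2)).add ((hqlim.pow 2).mul hNr)
    simpa using this
  have hqN : Tendsto (fun k => q k * (N k : ℝ)⁻¹) atTop (𝓝 0) := by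
    simpa using hqlim.mul hNr
  refine squeeze_zero' (Eventually.of_forall fun _ => dist_nonneg) ?_ hb
  filter_upwards [hz, hMlim.eventually_le_const one_pos, hqN.eventually_le_const one_pos,
    hN.eventually_ge_atTop 1] with k hzk hMk hqk hNk
  have hne : NeZero (N k) := ⟨by omega⟩
  have hn : (0 : ℝ) < N k := Nat.cast_pos.mpr hNk
  have hnC : (N k : ℂ) ≠ 0 := Nat.cast_ne_zero.mpr hne.out
  rw [dist_comm, dist_eq_norm, charFun_pairsLaw]
  set a : Fin (N k) → ℝ := fun i => s * (√(N k : ℝ))⁻¹ * z k i with ha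
  set ψ : ℂ := (N k : ℂ)⁻¹ * ∑ i, Complex.exp ((a i : ℂ) * Complex.I) with hψ
  have hsq : (√(N k : ℝ))⁻¹ ^ 2 = (N k : ℝ)⁻¹ := by
    rw [inv_pow, Real.sq_sqrt hn.le]
  have hasum : ∑ i, a i = 0 := by
    rw [ha, ← Finset.mul_sum, hzk, mul_zero]
  have ha2 : ∑ i, a i ^ 2 = 2 * q k := by
    simp only [ha, hq, mul_pow, hsq, ← Finset.mul_sum]
    ring
  have haM : ∀ i, |a i| ≤ M k := by
    intro i
    have h1 : a i ^ 4 ≤ s ^ 4 * (((N k : ℝ) ^ 2)⁻¹ * ∑ i, z k i ^ 4) := by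
      have h3 : a i ^ 4 = s ^ 4 * (((N k : ℝ) ^ 2)⁻¹ * z k i ^ 4) := by
        have : (√(N k : ℝ))⁻¹ ^ 4 = ((N k : ℝ) ^ 2)⁻¹ := by
          rw [show (4 : ℕ) = 2 * 2 from rfl, pow_mul, hsq, inv_pow]
        simp only [ha, mul_pow, this]
        ring
      rw [h3]
      gcongr
      exact Finset.single_le_sum (f := fun i => z k i ^ 4) (fun i _ => by positivity)
        (Finset.mem_univ i)
    refine Real.abs_le_sqrt (Real.le_sqrt_of_sq_le ?_)
    calc (a i ^ 2) ^ 2 = a i ^ 4 := by ring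
      _ ≤ _ := h1
  have hq0 : 0 ≤ q k := by simp only [hq]; positivity
  have hψ1 : ‖ψ‖ ≤ 1 := by
    rw [hψ, norm_mul, norm_inv, Complex.norm_natCast, inv_mul_le_iff₀ hn]
    refine (norm_sum_le _ _).trans ?_
    simp [Complex.norm_exp_ofReal_mul_I]
  set χ : ℂ := Complex.exp (-((q k * (N k : ℝ)⁻¹ : ℝ) : ℂ)) with hχ
  have hχ1 : ‖χ‖ ≤ 1 := norm_exp_neg_ofReal_le_one (by positivity)
  have hχN : Complex.exp (-((q k : ℝ) : ℂ)) = χ ^ N k := by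
    rw [hχ, ← Complex.exp_nat_mul]
    congr 1
    push_cast
    field_simp
  rw [hχN]
  have hprod := norm_prod_sub_prod_le (Finset.univ : Finset (Fin (N k))) (fun _ => ψ) (fun _ => χ)
    (fun _ _ => hψ1) (fun _ _ => hχ1)
  simp only [Finset.prod_const, Finset.card_univ, Fintype.card_fin, Finset.sum_const,
    nsmul_eq_mul] at hprod
  refine hprod.trans ?_
  have hdecomp : (N k : ℂ) * (ψ - χ) =
      ∑ i, (Complex.exp ((a i : ℂ) * Complex.I) - 1 - (a i : ℂ) * Complex.I + (a i : ℂ) ^ 2 / 2)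
        - (N k : ℂ) * (χ - 1 - (-((q k * (N k : ℝ)⁻¹ : ℝ) : ℂ))) := by
    have e1 : ∑ i, (a i : ℂ) = 0 := by exact_mod_cast hasum
    have e2 : ∑ i, (a i : ℂ) ^ 2 = 2 * (q k : ℂ) := by exact_mod_cast ha2
    have e3 : (N k : ℂ) * ψ = ∑ i, Complex.exp ((a i : ℂ) * Complex.I) := by
      rw [hψ, mul_inv_cancel_left₀ hnC]
    have e4 : (N k : ℂ) * ((q k * (N k : ℝ)⁻¹ : ℝ) : ℂ) = q k := by
      push_cast
      field_simp
    rw [Finset.sum_add_distrib, Finset.sum_sub_distrib, Finset.sum_sub_distrib, ← Finset.sum_mul,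
      ← Finset.sum_div, e1, e2, ← e3]
    simp only [Finset.sum_const, Finset.card_univ, Fintype.card_fin, nsmul_eq_mul]
    linear_combination e4
  have hnorm : (N k : ℝ) * ‖ψ - χ‖ = ‖(N k : ℂ) * (ψ - χ)‖ := by
    rw [norm_mul, Complex.norm_natCast]
  rw [hnorm, hdecomp]
  refine (norm_sub_le _ _).trans (add_le_add ?_ ?_)
  · calc _ ≤ ∑ i, 3 * |a i| ^ 3 := (norm_sum_le _ _).trans
          (Finset.sum_le_sum fun i _ => norm_exp_mul_I_sub_le ((haM i).trans hMk))
      _ ≤ ∑ i, 3 * (M k * a i ^ 2) := by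
          refine Finset.sum_le_sum fun i _ => ?_
          have : |a i| ^ 3 = |a i| * a i ^ 2 := by rw [pow_succ', sq_abs]
          rw [this]
          gcongr
          exact haM i
      _ = 3 * M k * (2 * q k) := by
          rw [← ha2, ← Finset.mul_sum, ← Finset.mul_sum]
          ring
  · have h := Complex.norm_exp_sub_one_sub_id_le (x := -((q k * (N k : ℝ)⁻¹ : ℝ) : ℂ))
      (by
        rw [norm_neg, Complex.norm_real, Real.norm_eq_abs, abs_of_nonneg (by positivity)]
        exact hqk)
    rw [norm_neg, Complex.norm_real, Real.norm_eq_abs, sq_abs] at h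
    rw [norm_mul, Complex.norm_natCast]
    calc _ ≤ (N k : ℝ) * (q k * (N k : ℝ)⁻¹) ^ 2 := by gcongr
      _ = q k ^ 2 * (N k : ℝ)⁻¹ := by
        field_simp

end PairsLaw


/-! ### Algebra of the ridge and least squares estimators -/

section RidgeAlgebra

variable {n p : ℕ}

lemma Sxx_mulVec (xs : Fin n → Fin p → ℝ) (v : Fin p → ℝ) :
    Sxx xs *ᵥ v = (n : ℝ)⁻¹ • ∑ t, (v ⬝ᵥ xs t) • xs t := by
  rw [Sxx, smul_mulVec, sum_mulVec]
  congr 1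
  refine Finset.sum_congr rfl fun t _ => ?_
  rw [vecMulVec_mulVec, dotProduct_comm]
  ext a
  simp [mul_comm]

lemma Sxx_apply (xs : Fin n → Fin p → ℝ) (a b : Fin p) :
    Sxx xs a b = (n : ℝ)⁻¹ * ∑ t, xs t a * xs t b := by
  simp [Sxx, Matrix.sum_apply, vecMulVec_apply]

/-- Decomposition of `S_xy` when `y_t = b' x_t + e_t`. -/
lemma Sxy_eq_add (xs : Fin n → Fin p → ℝ) (ys : Fin n → ℝ) (b : Fin p → ℝ) :
    Sxy xs ys = Sxx xs *ᵥ b + Sxy xs (fun t => ys t - b ⬝ᵥ xs t) := by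
  rw [Sxx_mulVec, Sxy, Sxy, ← smul_add, ← Finset.sum_add_distrib]
  congr 1
  refine Finset.sum_congr rfl fun t _ => ?_
  rw [← add_smul]
  congr 1
  ring

/-- The least squares residuals. -/
noncomputable def resid (xs : Fin n → Fin p → ℝ) (ys : Fin n → ℝ) (t : Fin n) : ℝ :=
  ys t - ols xs ys ⬝ᵥ xs t

lemma Sxy_resid {xs : Fin n → Fin p → ℝ} (hS : IsUnit (Sxx xs).det) (ys : Fin n → ℝ) :
    Sxy xs (resid xs ys) = 0 := by
  have h := Sxy_eq_add xs ys (ols xs ys)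
  have h2 : Sxx xs *ᵥ ols xs ys = Sxy xs ys := by
    rw [ols, mulVec_mulVec, mul_nonsing_inv _ hS, one_mulVec]
  rw [h2] at h
  exact (left_eq_add.mp h)

/-- The normal equations: the residuals are orthogonal to the regressors. This is what centers the
score of the bootstrap sample at zero. -/
lemma sum_resid_mul [NeZero n] {xs : Fin n → Fin p → ℝ} (hS : IsUnit (Sxx xs).det)
    (ys : Fin n → ℝ) (a : Fin p) : ∑ t, resid xs ys t * xs t a = 0 := by
  have h := congrFun (Sxy_resid hS ys) a
  have hn : (n : ℝ) ≠ 0 := Nat.cast_ne_zero.mpr (NeZero.ne n)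
  simpa [Sxy, hn, Finset.sum_apply] using h

lemma inv_mul_mul_sqrt (hn : 0 < n) (c : ℝ) :
    (n : ℝ)⁻¹ * c * √(n : ℝ) = c * (√(n : ℝ))⁻¹ := by
  have hn' : (0 : ℝ) < n := Nat.cast_pos.mpr hn
  have hsq := (Real.sqrt_pos.mpr hn').ne'
  rw [mul_right_comm, mul_comm c]
  congr 1
  rw [inv_mul_eq_iff_eq_mul₀ hn'.ne', eq_comm, mul_inv_eq_iff_eq_mul₀ hsq]
  exact (Real.mul_self_sqrt hn'.le).symm

/-- The normalized score of the bootstrap sample: the centered bootstrap ridge estimator is a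
linear transformation of it. It adds, to the resampled score `x* ê*`, the effect of
resampling `S_xx` on the ridge bias. -/
noncomputable def bootScore (c : ℝ) (xs : Fin n → Fin p → ℝ) (ys : Fin n → ℝ) (j : Fin n → Fin n) :
    Fin p → ℝ :=
  √(n : ℝ) • Sxy (fun t => xs (j t)) (fun t => resid xs ys (j t)) +
    ((n : ℝ)⁻¹ * c * √(n : ℝ)) •
      ((Sxx (fun t => xs (j t)) - Sxx xs) *ᵥ ((SxxRidge c xs)⁻¹ *ᵥ ols xs ys))

/-- The bootstrap statistic, centered at the estimated bias, is linear in the bootstrap score. This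
follows from `S*_xy = S*_xx θ̂ + S*_xê` and the resolvent identity
`S̃⁻¹ - S̃*⁻¹ = S̃*⁻¹ (S*_xx - S_xx) S̃⁻¹`. -/
lemma boot_stat_eq [NeZero n] (c : ℝ) (xs : Fin n → Fin p → ℝ) (ys : Fin n → ℝ)
    (j : Fin n → Fin n) (g : Fin p → ℝ) (hA : IsUnit (SxxRidge c fun t => xs (j t)).det)
    (hB : IsUnit (SxxRidge c xs).det) :
    √(n : ℝ) * (g ⬝ᵥ (ridge c (fun t => xs (j t)) (fun t => ys (j t)) - ols xs ys)) -
      -c * (√(n : ℝ))⁻¹ * (g ⬝ᵥ (SxxRidge c xs)⁻¹ *ᵥ ols xs ys) =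
    g ⬝ᵥ (SxxRidge c fun t => xs (j t))⁻¹ *ᵥ bootScore c xs ys j := by
  set b := ols xs ys with hb
  set xb : Fin n → Fin p → ℝ := fun t => xs (j t) with hxb
  set A := SxxRidge c xb with hAdef
  set B := SxxRidge c xs with hBdef
  have hc1 := inv_mul_mul_sqrt (Nat.pos_of_ne_zero (NeZero.ne n)) c
  have hAinv : ∀ w, A⁻¹ *ᵥ (A *ᵥ w) = w := fun w => by
    rw [mulVec_mulVec, nonsing_inv_mul _ hA, one_mulVec]
  have hBinv : ∀ w, B *ᵥ (B⁻¹ *ᵥ w) = w := fun w => by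
    rw [mulVec_mulVec, mul_nonsing_inv _ hB, one_mulVec]
  have hAB : Sxx xb - Sxx xs = A - B := by
    simp only [hAdef, hBdef, SxxRidge]
    abel
  have hSA : Sxx xb *ᵥ b = A *ᵥ b - ((n : ℝ)⁻¹ * c) • b := by
    rw [hAdef, SxxRidge, add_mulVec, smul_mulVec, one_mulVec, add_sub_cancel_right]
  have hSxy : Sxy xb (fun t => ys (j t)) =
      A *ᵥ b - ((n : ℝ)⁻¹ * c) • b + Sxy xb (fun t => resid xs ys (j t)) := by
    rw [Sxy_eq_add xb _ b, hSA]
    rfl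
  have hridge : ridge c xb (fun t => ys (j t)) - b =
      A⁻¹ *ᵥ Sxy xb (fun t => resid xs ys (j t)) - ((n : ℝ)⁻¹ * c) • (A⁻¹ *ᵥ b) := by
    rw [ridge, hSxy, ← hAdef, mulVec_add, mulVec_sub, hAinv, mulVec_smul]
    abel
  have hscore : A⁻¹ *ᵥ bootScore c xs ys j = √(n : ℝ) • (A⁻¹ *ᵥ Sxy xb
      (fun t => resid xs ys (j t))) + (c * (√(n : ℝ))⁻¹) • (B⁻¹ *ᵥ b - A⁻¹ *ᵥ b) := by
    rw [bootScore, ← hxb, hAB, ← hBdef, ← hb, mulVec_add, mulVec_smul, mulVec_smul, sub_mulVec,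
      hBinv, mulVec_sub, hAinv, hc1]
  rw [hridge, hscore]
  simp only [dotProduct_add, dotProduct_sub, dotProduct_smul, smul_eq_mul]
  linear_combination (-(g ⬝ᵥ A⁻¹ *ᵥ b)) * hc1

lemma sq_dotProduct_le (u v : Fin p → ℝ) : (u ⬝ᵥ v) ^ 2 ≤ (u ⬝ᵥ u) * (v ⬝ᵥ v) := by
  have h := Finset.sum_mul_sq_le_sq_mul_sq Finset.univ u v
  simpa [dotProduct, sq] using h

lemma sq_apply_le_dotProduct_self (u : Fin p → ℝ) (a : Fin p) : u a ^ 2 ≤ u ⬝ᵥ u := by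
  have := Finset.single_le_sum (f := fun a => u a * u a) (fun i _ => mul_self_nonneg _)
    (Finset.mem_univ a)
  simpa [dotProduct, sq] using this

lemma dotProduct_self_nonneg_real (u : Fin p → ℝ) : 0 ≤ u ⬝ᵥ u :=
  Finset.sum_nonneg fun _ _ => mul_self_nonneg _

/-- The normalized fourth moment `n⁻² ∑ (x_t'x_t)²` of the regressors. -/
noncomputable def fourthMoment (xs : Fin n → Fin p → ℝ) : ℝ :=
  ((n : ℝ) ^ 2)⁻¹ * ∑ t, (xs t ⬝ᵥ xs t) ^ 2

lemma fourthMoment_nonneg (xs : Fin n → Fin p → ℝ) : 0 ≤ fourthMoment xs := by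
  unfold fourthMoment
  positivity

/-- Under the bootstrap law, the resampled `S_xx` has mean `S_xx` and variance of order the
normalized fourth moment of the regressors. -/
lemma integral_Sxx_sub_sq_le [NeZero n] (xs : Fin n → Fin p → ℝ) (a b : Fin p) :
    ∫ j, (Sxx (fun t => xs (j t)) a b - Sxx xs a b) ^ 2 ∂(pairsLaw n) ≤ fourthMoment xs := by
  have hn : (n : ℝ) ≠ 0 := Nat.cast_ne_zero.mpr (NeZero.ne n)
  set f : Fin n → ℝ := fun i => xs i a * xs i b with hf
  set m : ℝ := (n : ℝ)⁻¹ * ∑ i, f i with hm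
  have hnm : ∑ i, f i = n * m := by rw [hm, mul_inv_cancel_left₀ hn]
  have hcent : ∑ i, (f i - m) = 0 := by
    rw [Finset.sum_sub_distrib, hnm]
    simp
  have heq : ∀ j : Fin n → Fin n, (Sxx (fun t => xs (j t)) a b - Sxx xs a b) ^ 2 =
      ((n : ℝ) ^ 2)⁻¹ * (∑ t, (f (j t) - m)) ^ 2 := by
    intro j
    have h1 : ∑ t, (f (j t) - m) = ∑ t, f (j t) - n * m := by
      rw [Finset.sum_sub_distrib]
      simp
    rw [Sxx_apply, Sxx_apply, h1, ← inv_pow, ← mul_pow, mul_sub, inv_mul_cancel_left₀ hn]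
  simp_rw [heq]
  rw [integral_const_mul, integral_sum_sq_pairsLaw (fun i => f i - m) hcent, fourthMoment]
  refine mul_le_mul_of_nonneg_left ?_ (by positivity)
  have h2 : ∑ i, (f i - m) ^ 2 = ∑ i, f i ^ 2 - n * m ^ 2 := by
    have : ∀ i, (f i - m) ^ 2 = f i ^ 2 - 2 * m * f i + m ^ 2 := fun i => by ring
    simp_rw [this]
    rw [Finset.sum_add_distrib, Finset.sum_sub_distrib, ← Finset.mul_sum, hnm]
    simp
    ring
  rw [h2]
  refine (sub_le_self _ (by positivity)).trans (Finset.sum_le_sum fun i _ => ?_)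
  have h3 := sq_apply_le_dotProduct_self (xs i) a
  have h4 := sq_apply_le_dotProduct_self (xs i) b
  calc f i ^ 2 = xs i a ^ 2 * xs i b ^ 2 := by rw [hf]; ring
    _ ≤ (xs i ⬝ᵥ xs i) * (xs i ⬝ᵥ xs i) := by gcongr; exact dotProduct_self_nonneg_real _
    _ = _ := by ring

end RidgeAlgebra

/-! ### Limits of matrices and their inverses -/

section InverseLimits

variable {p : ℕ} {ι : Type*} {l : Filter ι} {S : ι → Matrix (Fin p) (Fin p) ℝ}
  {Sig : Matrix (Fin p) (Fin p) ℝ}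

lemma eventually_isUnit_det (hS : Tendsto S l (𝓝 Sig)) (hSig : Sig.PosDef) :
    ∀ᶠ i in l, IsUnit (S i).det := by
  have hc : Continuous fun M : Matrix (Fin p) (Fin p) ℝ => M.det := continuous_id.matrix_det
  have h := (hc.tendsto Sig).comp hS
  filter_upwards [h.eventually_ne (isUnit_det_of_posDef hSig).ne_zero] with i hi
  exact isUnit_iff_ne_zero.mpr hi

lemma tendsto_matrix_inv (hS : Tendsto S l (𝓝 Sig)) (hSig : Sig.PosDef) :
    Tendsto (fun i => (S i)⁻¹) l (𝓝 Sig⁻¹) :=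
  (continuousAt_matrix_inv (isUnit_det_of_posDef hSig)).tendsto.comp hS

lemma tendsto_SxxRidge {n : ι → ℕ} {c : ι → ℝ} {c₀ : ℝ} {xs : ∀ i, Fin (n i) → Fin p → ℝ}
    (hS : Tendsto (fun i => Sxx (xs i)) l (𝓝 Sig))
    (hc : Tendsto (fun i => (n i : ℝ)⁻¹ * c i) l (𝓝 c₀)) :
    Tendsto (fun i => SxxRidge (c i) (xs i)) l (𝓝 (SigTilde c₀ Sig)) :=
  hS.add (hc.smul_const _)

lemma tendsto_dotProduct {u v : ι → Fin p → ℝ} {u₀ v₀ : Fin p → ℝ} (hu : Tendsto u l (𝓝 u₀))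
    (hv : Tendsto v l (𝓝 v₀)) : Tendsto (fun i => u i ⬝ᵥ v i) l (𝓝 (u₀ ⬝ᵥ v₀)) := by
  have hc : Continuous fun w : (Fin p → ℝ) × (Fin p → ℝ) => w.1 ⬝ᵥ w.2 :=
    continuous_fst.dotProduct continuous_snd
  exact (hc.tendsto (u₀, v₀)).comp (hu.prodMk_nhds hv)

lemma tendsto_mulVec {v : ι → Fin p → ℝ} {v₀ : Fin p → ℝ} (hS : Tendsto S l (𝓝 Sig))
    (hv : Tendsto v l (𝓝 v₀)) : Tendsto (fun i => S i *ᵥ v i) l (𝓝 (Sig *ᵥ v₀)) := by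
  have hc : Continuous fun w : Matrix (Fin p) (Fin p) ℝ × (Fin p → ℝ) => w.1 *ᵥ w.2 :=
    continuous_fst.matrix_mulVec continuous_snd
  exact (hc.tendsto (Sig, v₀)).comp (hS.prodMk_nhds hv)

end InverseLimits


/-! ### The pairs bootstrap along a deterministic sequence of data sets -/

section BootstrapLimit

variable {p : ℕ} {N : ℕ → ℕ} {xs : ∀ k, Fin (N k) → Fin p → ℝ} {ys : ∀ k, Fin (N k) → ℝ}
  {c : ℕ → ℝ} {sigma2 c₀ : ℝ} {Sig : Matrix (Fin p) (Fin p) ℝ} {g : Fin p → ℝ}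

/-- Under the bootstrap law, the resampled second moment matrix converges in probability. -/
lemma tendsto_Sxx_boot (hN : Tendsto N atTop atTop)
    (hS : Tendsto (fun k => Sxx (xs k)) atTop (𝓝 Sig))
    (h4 : Tendsto (fun k => fourthMoment (xs k)) atTop (𝓝 0)) :
    Tendsto (fun z : Σ k, (Fin (N k) → Fin (N k)) => Sxx fun t => xs z.1 (z.2 t))
      (probFilter atTop fun k => pairsLaw (N k)) (𝓝 Sig) := by
  rw [tendsto_matrix_iff]
  intro a b
  have h1 : Tendsto (fun z : Σ k, (Fin (N k) → Fin (N k)) =>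
      Sxx (fun t => xs z.1 (z.2 t)) a b - Sxx (xs z.1) a b)
      (probFilter atTop fun k => pairsLaw (N k)) (𝓝 0) := by
    refine tendsto_probFilter_of_integral_sq (Eventually.of_forall fun _ => .of_finite) ?_
    refine squeeze_zero' (Eventually.of_forall fun k => integral_nonneg fun _ => sq_nonneg _)
      ?_ h4
    filter_upwards [hN.eventually_ge_atTop 1] with k hk
    have : NeZero (N k) := ⟨by omega⟩
    exact integral_Sxx_sub_sq_le (xs k) a b
  have h2 : Tendsto (fun z : Σ k, (Fin (N k) → Fin (N k)) => Sxx (xs z.1) a b)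
      (probFilter atTop fun k => pairsLaw (N k)) (𝓝 (Sig a b)) :=
    (tendsto_matrix_iff.mp hS a b).comp tendsto_fst_probFilter
  simpa using h1.add h2

/-- Pairs bootstrap central limit theorem along a deterministic sequence of data sets: the
hypotheses on the moments of regressors and residuals are those that hold in probability for the
random data, and they imply convergence of the characteristic function of the centered bootstrap
statistic. By `boot_stat_eq` that statistic is `g'S̃*⁻¹` times the score `Z + D`, where `Z` obeys
the central limit theorem, `D` vanishes in `L²` and `S̃*` is consistent. -/
theorem tendsto_charFun_boot (hN : Tendsto N atTop atTop)
    (hS : Tendsto (fun k => Sxx (xs k)) atTop (𝓝 Sig)) (hSig : Sig.PosDef)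
    (hc : Tendsto (fun k => (N k : ℝ)⁻¹ * c k) atTop (𝓝 c₀)) (hc₀ : 0 ≤ c₀)
    (h4 : Tendsto (fun k => fourthMoment (xs k)) atTop (𝓝 0))
    (hM : ∀ a b, Tendsto (fun k => (N k : ℝ)⁻¹ *
      ∑ i, resid (xs k) (ys k) i ^ 2 * (xs k i a * xs k i b)) atTop (𝓝 (sigma2 * Sig a b)))
    (he4 : Tendsto (fun k => ((N k : ℝ) ^ 2)⁻¹ *
      ∑ i, resid (xs k) (ys k) i ^ 4 * (xs k i ⬝ᵥ xs k i) ^ 2) atTop (𝓝 0))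
    (hols : Tendsto (fun k => N k * fourthMoment (xs k) *
      (ols (xs k) (ys k) ⬝ᵥ ols (xs k) (ys k))) atTop (𝓝 0)) (s : ℝ) :
    Tendsto (fun k => charFun ((pairsLaw (N k)).map fun j =>
      √(N k : ℝ) * (g ⬝ᵥ (ridge (c k) (fun t => xs k (j t)) (fun t => ys k (j t))
        - ols (xs k) (ys k))) -
      -(c k) * (√(N k : ℝ))⁻¹ * (g ⬝ᵥ (SxxRidge (c k) (xs k))⁻¹ *ᵥ ols (xs k) (ys k))) s) atTop
      (𝓝 (Complex.exp (-((V g c₀ sigma2 Sig 0 0 * s ^ 2 / 2 : ℝ) : ℂ)))) := by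
  set 𝓕 := probFilter atTop fun k => pairsLaw (N k) with h𝓕
  have hfst : Tendsto Sigma.fst 𝓕 atTop := tendsto_fst_probFilter
  set h := (SigTilde c₀ Sig)⁻¹ *ᵥ g with hh
  have hT := transpose_inv_SigTilde hSig hc₀
  have hTpd := posDef_SigTilde hSig hc₀
  -- the variance of the limit, as a quadratic form in `h`
  have hv : V g c₀ sigma2 Sig 0 0 = sigma2 * (h ⬝ᵥ Sig *ᵥ h) := by
    rw [V_eq hSig hc₀ h hh]
    simp
  have hSB := tendsto_SxxRidge hS hc
  have hSboot := tendsto_Sxx_boot hN hS h4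
  have hAboot : Tendsto (fun z : Σ k, (Fin (N k) → Fin (N k)) =>
      SxxRidge (c z.1) fun t => xs z.1 (z.2 t)) 𝓕 (𝓝 (SigTilde c₀ Sig)) :=
    tendsto_SxxRidge hSboot (hc.comp hfst)
  set Astar : (Σ k, (Fin (N k) → Fin (N k))) → Matrix (Fin p) (Fin p) ℝ :=
    fun z => SxxRidge (c z.1) fun t => xs z.1 (z.2 t) with hAstar
  -- the leading term of the bootstrap score
  set Z : (Σ k, (Fin (N k) → Fin (N k))) → Fin p → ℝ := fun z a =>
    (√(N z.1 : ℝ))⁻¹ * ∑ t, resid (xs z.1) (ys z.1) (z.2 t) * xs z.1 (z.2 t) a with hZ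
  have hZint : ∀ᶠ k in atTop, ∀ a, ∫ j, Z ⟨k, j⟩ a ^ 2 ∂(pairsLaw (N k)) =
      (N k : ℝ)⁻¹ * ∑ i, resid (xs k) (ys k) i ^ 2 * (xs k i a * xs k i a) := by
    filter_upwards [hN.eventually_ge_atTop 1, eventually_isUnit_det hS hSig] with k hk hu a
    have : NeZero (N k) := ⟨by omega⟩
    simp only [hZ, mul_pow, inv_pow, Real.sq_sqrt (Nat.cast_nonneg (N k))]
    rw [integral_const_mul, integral_sum_sq_pairsLaw
      (fun i => resid (xs k) (ys k) i * xs k i a) (sum_resid_mul hu (ys k) a)]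
    congr 1
    refine Finset.sum_congr rfl fun i _ => ?_
    ring
  -- the second term of the bootstrap score
  set w : ℕ → Fin p → ℝ := fun k => (SxxRidge (c k) (xs k))⁻¹ *ᵥ ols (xs k) (ys k) with hw
  set D : (Σ k, (Fin (N k) → Fin (N k))) → Fin p → ℝ := fun z a =>
    ∑ b, ((N z.1 : ℝ)⁻¹ * c z.1) *
      ((Sxx (fun t => xs z.1 (z.2 t)) a b - Sxx (xs z.1) a b) * (√(N z.1 : ℝ) * w z.1 b)) with hD
  have hscore : ∀ᶠ z : Σ k, (Fin (N k) → Fin (N k)) in 𝓕,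
      bootScore (c z.1) (xs z.1) (ys z.1) z.2 = Z z + D z := by
    filter_upwards [hfst.eventually (hN.eventually_ge_atTop 1)] with z hz
    have hNz : (0 : ℝ) < N z.1 := Nat.cast_pos.mpr hz
    have hsq : √(N z.1 : ℝ) * (N z.1 : ℝ)⁻¹ = (√(N z.1 : ℝ))⁻¹ := by
      have hne := (Real.sqrt_pos.mpr hNz).ne'
      rw [mul_inv_eq_iff_eq_mul₀ hNz.ne', eq_comm, inv_mul_eq_iff_eq_mul₀ hne]
      exact (Real.mul_self_sqrt hNz.le).symm
    ext a
    simp only [bootScore, Sxy, hZ, hD, hw, Pi.add_apply, Pi.smul_apply, smul_eq_mul,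
      Finset.sum_apply]
    rw [← mul_assoc, hsq]
    congr 1
    rw [Matrix.mulVec, dotProduct, Finset.mul_sum]
    refine Finset.sum_congr rfl fun b _ => ?_
    rw [Matrix.sub_apply]
    ring
  have hwlim : ∀ b, Tendsto (fun k => √(N k * fourthMoment (xs k)) * w k b) atTop (𝓝 0) := by
    have hθ : Tendsto (fun k => √(N k * fourthMoment (xs k)) • ols (xs k) (ys k)) atTop
        (𝓝 0) := by
      rw [tendsto_pi_nhds]
      intro d
      have hsq := (Real.continuous_sqrt.tendsto 0).comp hols
      rw [Real.sqrt_zero] at hsq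
      refine squeeze_zero_norm (fun k => ?_) hsq
      rw [Real.norm_eq_abs]
      have hnn : 0 ≤ (N k : ℝ) * fourthMoment (xs k) :=
        mul_nonneg (Nat.cast_nonneg _) (fourthMoment_nonneg _)
      refine Real.abs_le_sqrt ?_
      rw [Pi.smul_apply, smul_eq_mul, mul_pow, Real.sq_sqrt hnn]
      exact mul_le_mul_of_nonneg_left (sq_apply_le_dotProduct_self _ _) hnn
    have := tendsto_mulVec (tendsto_matrix_inv hSB hTpd) hθ
    rw [mulVec_zero, tendsto_pi_nhds] at this
    intro b
    refine (this b).congr fun k => ?_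
    rw [mulVec_smul, Pi.smul_apply, smul_eq_mul]
  have hDlim : ∀ a, Tendsto (fun z => D z a) 𝓕 (𝓝 0) := by
    intro a
    rw [← Finset.sum_const_zero (s := (Finset.univ : Finset (Fin p)))]
    refine tendsto_finsetSum _ fun b _ => ?_
    have hterm : Tendsto (fun z : Σ k, (Fin (N k) → Fin (N k)) =>
        (Sxx (fun t => xs z.1 (z.2 t)) a b - Sxx (xs z.1) a b) * (√(N z.1 : ℝ) * w z.1 b))
        𝓕 (𝓝 0) := by
      refine tendsto_probFilter_of_integral_sq (Eventually.of_forall fun _ => .of_finite) ?_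
      have hlim := (hwlim b).pow 2
      rw [zero_pow two_ne_zero] at hlim
      refine squeeze_zero' (Eventually.of_forall fun k => integral_nonneg fun _ => sq_nonneg _)
        ?_ hlim
      filter_upwards [hN.eventually_ge_atTop 1] with k hk
      have : NeZero (N k) := ⟨by omega⟩
      have hnn : 0 ≤ (N k : ℝ) * fourthMoment (xs k) :=
        mul_nonneg (Nat.cast_nonneg _) (fourthMoment_nonneg _)
      simp only [mul_pow, Real.sq_sqrt hnn, Real.sq_sqrt (Nat.cast_nonneg (N k))]
      rw [integral_mul_const]
      have hb := integral_Sxx_sub_sq_le (xs k) a b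
      calc _ ≤ fourthMoment (xs k) * (N k * w k b ^ 2) :=
            mul_le_mul_of_nonneg_right hb (by positivity)
        _ = _ := by ring
    simpa using (hc.comp hfst).mul hterm
  -- the coefficients of the score
  set hs : (Σ k, (Fin (N k) → Fin (N k))) → Fin p → ℝ := fun z => g ᵥ* (Astar z)⁻¹ with hhs
  have hhlim : ∀ a, Tendsto (fun z => hs z a) 𝓕 (𝓝 (h a)) := by
    have hinv := tendsto_matrix_inv hAboot hTpd
    have hcont : Continuous fun M : Matrix (Fin p) (Fin p) ℝ => g ᵥ* M :=
      continuous_const.matrix_vecMul continuous_id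
    have h1 := (hcont.tendsto _).comp hinv
    have h2 : g ᵥ* (SigTilde c₀ Sig)⁻¹ = h := by
      rw [hh, ← mulVec_transpose, hT]
    rw [h2] at h1
    exact fun a => (tendsto_pi_nhds.mp h1) a
  -- the leading term satisfies the central limit theorem
  set zz : ∀ k, Fin (N k) → ℝ := fun k i => resid (xs k) (ys k) i * (h ⬝ᵥ xs k i) with hzz
  have hzsum : ∀ᶠ k in atTop, ∑ i, zz k i = 0 := by
    filter_upwards [hN.eventually_ge_atTop 1, eventually_isUnit_det hS hSig] with k hk hu
    have : NeZero (N k) := ⟨by omega⟩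
    have h1 : ∑ i, zz k i = ∑ a, h a * ∑ i, resid (xs k) (ys k) i * xs k i a := by
      simp only [hzz, dotProduct, Finset.mul_sum]
      rw [Finset.sum_comm]
      refine Finset.sum_congr rfl fun a _ => Finset.sum_congr rfl fun i _ => ?_
      ring
    rw [h1]
    exact Finset.sum_eq_zero fun a _ => by rw [sum_resid_mul hu (ys k) a, mul_zero]
  have hz2 : Tendsto (fun k => (N k : ℝ)⁻¹ * ∑ i, zz k i ^ 2) atTop
      (𝓝 (sigma2 * (h ⬝ᵥ Sig *ᵥ h))) := by
    have h1 : Tendsto (fun k => ∑ a, ∑ b, h a * h b * ((N k : ℝ)⁻¹ *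
        ∑ i, resid (xs k) (ys k) i ^ 2 * (xs k i a * xs k i b))) atTop
        (𝓝 (∑ a, ∑ b, h a * h b * (sigma2 * Sig a b))) :=
      tendsto_finsetSum _ fun a _ => tendsto_finsetSum _ fun b _ => (hM a b).const_mul _
    have h2 : sigma2 * (h ⬝ᵥ Sig *ᵥ h) = ∑ a, ∑ b, h a * h b * (sigma2 * Sig a b) := by
      simp only [dotProduct, Matrix.mulVec, Finset.mul_sum]
      refine Finset.sum_congr rfl fun a _ => Finset.sum_congr rfl fun b _ => ?_
      ring
    rw [h2]
    refine h1.congr fun k => ?_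
    have h3 : ∀ i, zz k i ^ 2 =
        ∑ a, ∑ b, h a * h b * (resid (xs k) (ys k) i ^ 2 * (xs k i a * xs k i b)) := by
      intro i
      rw [hzz, mul_pow, sq (h ⬝ᵥ xs k i), dotProduct, Finset.sum_mul_sum, Finset.mul_sum]
      refine Finset.sum_congr rfl fun a _ => ?_
      rw [Finset.mul_sum]
      refine Finset.sum_congr rfl fun b _ => ?_
      ring
    simp_rw [h3, Finset.mul_sum]
    symm
    rw [Finset.sum_comm]
    refine Finset.sum_congr rfl fun a _ => ?_
    rw [Finset.sum_comm]
    refine Finset.sum_congr rfl fun b _ => Finset.sum_congr rfl fun i _ => ?_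
    ring
  have hz4 : Tendsto (fun k => ((N k : ℝ) ^ 2)⁻¹ * ∑ i, zz k i ^ 4) atTop (𝓝 0) := by
    have hlim := he4.const_mul ((h ⬝ᵥ h) ^ 2)
    rw [mul_zero] at hlim
    refine squeeze_zero (fun k => by positivity) (fun k => ?_) hlim
    rw [mul_left_comm, Finset.mul_sum (a := (h ⬝ᵥ h) ^ 2)]
    refine mul_le_mul_of_nonneg_left (Finset.sum_le_sum fun i _ => ?_) (by positivity)
    have h1 := sq_dotProduct_le h (xs k i)
    calc zz k i ^ 4 = resid (xs k) (ys k) i ^ 4 * ((h ⬝ᵥ xs k i) ^ 2) ^ 2 := by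
          simp only [hzz]
          ring
      _ ≤ resid (xs k) (ys k) i ^ 4 * ((h ⬝ᵥ h) * (xs k i ⬝ᵥ xs k i)) ^ 2 := by gcongr
      _ = _ := by ring
  have hclt := tendsto_charFun_pairsLaw hN hzsum hz2 hz4 s
  rw [← hv] at hclt
  -- replace the leading term by the statistic
  refine tendsto_charFun_of_tendsto_sub (μ := fun k => pairsLaw (N k))
    (X := fun z => (√(N z.1 : ℝ))⁻¹ * ∑ t, zz z.1 (z.2 t))
    (Y := fun z => √(N z.1 : ℝ) * (g ⬝ᵥ (ridge (c z.1) (fun t => xs z.1 (z.2 t))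
        (fun t => ys z.1 (z.2 t)) - ols (xs z.1) (ys z.1))) -
      -(c z.1) * (√(N z.1 : ℝ))⁻¹ *
        (g ⬝ᵥ (SxxRidge (c z.1) (xs z.1))⁻¹ *ᵥ ols (xs z.1) (ys z.1)))
    (fun k => Measurable.of_discrete) (fun k => Measurable.of_discrete) hclt ?_
  have hrem : Tendsto (fun z => ∑ a, (hs z a - h a) * Z z a + ∑ a, hs z a * D z a) 𝓕 (𝓝 0) := by
    have h1 : Tendsto (fun z => ∑ a, (hs z a - h a) * Z z a) 𝓕 (𝓝 0) := by
      rw [← Finset.sum_const_zero (s := (Finset.univ : Finset (Fin p)))]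
      refine tendsto_finsetSum _ fun a _ => ?_
      refine tendsto_probFilter_mul_of_integral_sq_le (C := sigma2 * Sig a a + 1)
        (tendsto_sub_nhds_zero_iff.mpr (hhlim a)) (Eventually.of_forall fun _ => .of_finite) ?_
      filter_upwards [hZint, (hM a a).eventually_le_const (lt_add_one _)] with k hk hk2
      rw [hk a]
      exact hk2
    have h2 : Tendsto (fun z => ∑ a, hs z a * D z a) 𝓕 (𝓝 0) := by
      rw [← Finset.sum_const_zero (s := (Finset.univ : Finset (Fin p)))]
      refine tendsto_finsetSum _ fun a _ => ?_
      simpa using (hhlim a).mul (hDlim a)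
    simpa using h1.add h2
  refine hrem.congr' ?_
  filter_upwards [hscore, eventually_isUnit_det hAboot hTpd,
    hfst.eventually (eventually_isUnit_det hSB hTpd),
    hfst.eventually (hN.eventually_ge_atTop 1)] with z hz hA hB hz1
  have : NeZero (N z.1) := ⟨by omega⟩
  rw [boot_stat_eq (c z.1) (xs z.1) (ys z.1) z.2 g hA hB, hz, dotProduct_mulVec]
  have hlead : (√(N z.1 : ℝ))⁻¹ * ∑ t, zz z.1 (z.2 t) = ∑ a, h a * Z z a := by
    simp only [hzz, hZ, dotProduct, Finset.mul_sum]
    rw [Finset.sum_comm]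
    refine Finset.sum_congr rfl fun a _ => Finset.sum_congr rfl fun i _ => ?_
    ring
  rw [hlead]
  simp only [dotProduct, Pi.add_apply, mul_add, sub_mul, Finset.sum_add_distrib,
    Finset.sum_sub_distrib, hhs]
  ring

/-- The conclusion of `tendsto_charFun_boot` in terms of distribution functions. -/
theorem tendsto_cdf_boot (hN : Tendsto N atTop atTop)
    (hS : Tendsto (fun k => Sxx (xs k)) atTop (𝓝 Sig)) (hSig : Sig.PosDef)
    (hc : Tendsto (fun k => (N k : ℝ)⁻¹ * c k) atTop (𝓝 c₀)) (hc₀ : 0 ≤ c₀)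
    (hs : 0 < sigma2) (hg : g ≠ 0)
    (h4 : Tendsto (fun k => fourthMoment (xs k)) atTop (𝓝 0))
    (hM : ∀ a b, Tendsto (fun k => (N k : ℝ)⁻¹ *
      ∑ i, resid (xs k) (ys k) i ^ 2 * (xs k i a * xs k i b)) atTop (𝓝 (sigma2 * Sig a b)))
    (he4 : Tendsto (fun k => ((N k : ℝ) ^ 2)⁻¹ *
      ∑ i, resid (xs k) (ys k) i ^ 4 * (xs k i ⬝ᵥ xs k i) ^ 2) atTop (𝓝 0))
    (hols : Tendsto (fun k => N k * fourthMoment (xs k) *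
      (ols (xs k) (ys k) ⬝ᵥ ols (xs k) (ys k))) atTop (𝓝 0)) (u : ℝ) :
    Tendsto (fun k => (pairsLaw (N k)).real {j |
      √(N k : ℝ) * (g ⬝ᵥ (ridge (c k) (fun t => xs k (j t)) (fun t => ys k (j t))
        - ols (xs k) (ys k))) -
      -(c k) * (√(N k : ℝ))⁻¹ *
        (g ⬝ᵥ (SxxRidge (c k) (xs k))⁻¹ *ᵥ ols (xs k) (ys k)) ≤ u}) atTop
      (𝓝 ((gaussianReal 0 (V g c₀ sigma2 Sig 0 0).toNNReal).real (Set.Iic u))) := by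
  have hV := V_zero_zero_pos hSig hc₀ hs hg
  have hprob : ∀ k (f : (Fin (N k) → Fin (N k)) → ℝ),
      IsProbabilityMeasure ((pairsLaw (N k)).map f) := fun k f =>
    Measure.isProbabilityMeasure_map (Measurable.of_discrete).aemeasurable
  have h := tendsto_measureReal_Iic_of_charFun (v := (V g c₀ sigma2 Sig 0 0).toNNReal)
    (by simpa using hV) (fun s => by
      rw [Real.coe_toNNReal _ hV.le]
      exact tendsto_charFun_boot (g := g) hN hS hSig hc hc₀ h4 hM he4 hols s) u
  refine h.congr fun k => ?_
  rw [map_measureReal_apply Measurable.of_discrete measurableSet_Iic]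
  rfl

end BootstrapLimit


/-! ### Sample moments of regressors and residuals -/

section DataLimits

variable {Ω : Type*} {p : ℕ}

/-- The errors in the sample of size `n`. -/
def errData (ε : ℕ → Ω → ℝ) (n : ℕ) (ω : Ω) : Fin n → ℝ := fun t => ε t ω

lemma Sxy_yData (x : ℕ → Fin p → ℝ) (δ : Fin p → ℝ) (ε : ℕ → Ω → ℝ) (n : ℕ) (ω : Ω) :
    Sxy (xData x n) (yData x δ ε n ω) =
      Sxx (xData x n) *ᵥ theta δ n + Sxy (xData x n) (errData ε n ω) := by
  rw [Sxy_eq_add _ _ (theta δ n)]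
  congr 2
  ext t
  simp [yData, xData, errData]

lemma ols_sub_theta {x : ℕ → Fin p → ℝ} {n : ℕ} (hS : IsUnit (Sxx (xData x n)).det)
    (δ : Fin p → ℝ) (ε : ℕ → Ω → ℝ) (ω : Ω) :
    ols (xData x n) (yData x δ ε n ω) - theta δ n =
      (Sxx (xData x n))⁻¹ *ᵥ Sxy (xData x n) (errData ε n ω) := by
  rw [ols, Sxy_yData, mulVec_add, mulVec_mulVec, nonsing_inv_mul _ hS, one_mulVec,
    add_sub_cancel_left]

lemma resid_yData (x : ℕ → Fin p → ℝ) (δ : Fin p → ℝ) (ε : ℕ → Ω → ℝ) (n : ℕ) (ω : Ω)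
    (t : Fin n) : resid (xData x n) (yData x δ ε n ω) t =
      ε t ω - (ols (xData x n) (yData x δ ε n ω) - theta δ n) ⬝ᵥ xData x n t := by
  rw [resid, sub_dotProduct, yData, xData]
  ring

lemma sum_dotProduct_self_eq {n : ℕ} (xs : Fin n → Fin p → ℝ) (w : Fin n → ℝ) :
    (n : ℝ)⁻¹ * ∑ t, w t * (xs t ⬝ᵥ xs t) =
      ∑ a, (n : ℝ)⁻¹ * ∑ t, w t * (xs t a * xs t a) := by
  simp only [dotProduct, Finset.mul_sum]
  rw [Finset.sum_comm]

variable [MeasurableSpace Ω] {P : Measure Ω} {x : ℕ → Fin p → ℝ}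
  {ε : ℕ → Ω → ℝ} {c : ℕ → ℝ} {sigma2 c₀ : ℝ} {Sig : Matrix (Fin p) (Fin p) ℝ}

lemma dotProduct_self_le_iSup (x : ℕ → Fin p → ℝ) (n : ℕ) (t : Fin n) :
    xData x n t ⬝ᵥ xData x n t ≤ ⨆ t : Fin n, xData x n t ⬝ᵥ xData x n t :=
  le_ciSup (f := fun t : Fin n => xData x n t ⬝ᵥ xData x n t) (Set.finite_range _).bddAbove t

lemma tendsto_iSup_div (hmax : (fun n : ℕ => ⨆ t : Fin n, xData x n t ⬝ᵥ xData x n t)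
    =o[atTop] fun n : ℕ => (n : ℝ)) :
    Tendsto (fun n : ℕ => (n : ℝ)⁻¹ * ⨆ t : Fin n, xData x n t ⬝ᵥ xData x n t) atTop (𝓝 0) := by
  simpa only [div_eq_inv_mul] using hmax.tendsto_div_nhds_zero

/-- A small maximal regressor makes the normalized fourth moment of the regressors negligible. -/
lemma tendsto_fourthMoment (hS : Tendsto (fun n => Sxx (xData x n)) atTop (𝓝 Sig))
    (hmax : (fun n : ℕ => ⨆ t : Fin n, xData x n t ⬝ᵥ xData x n t)
      =o[atTop] fun n : ℕ => (n : ℝ)) :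
    Tendsto (fun n => fourthMoment (xData x n)) atTop (𝓝 0) := by
  have htr : Tendsto (fun n => ∑ a, Sxx (xData x n) a a) atTop (𝓝 (∑ a, Sig a a)) :=
    tendsto_finsetSum _ fun a _ => tendsto_matrix_iff.mp hS a a
  have hlim := (tendsto_iSup_div hmax).mul htr
  rw [zero_mul] at hlim
  refine squeeze_zero (fun n => fourthMoment_nonneg _) (fun n => ?_) hlim
  have h1 : ∑ a, Sxx (xData x n) a a = (n : ℝ)⁻¹ * ∑ t, xData x n t ⬝ᵥ xData x n t := by
    have := sum_dotProduct_self_eq (xData x n) fun _ => 1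
    simp only [one_mul] at this
    rw [this]
    exact Finset.sum_congr rfl fun a _ => Sxx_apply _ _ _
  rw [h1, fourthMoment]
  calc _ ≤ ((n : ℝ) ^ 2)⁻¹ * ∑ t, (⨆ t : Fin n, xData x n t ⬝ᵥ xData x n t) *
          (xData x n t ⬝ᵥ xData x n t) := by
        refine mul_le_mul_of_nonneg_left (Finset.sum_le_sum fun t _ => ?_) (by positivity)
        rw [sq]
        exact mul_le_mul_of_nonneg_right (dotProduct_self_le_iSup x n t)
          (dotProduct_self_nonneg_real _)
    _ = _ := by
        rw [← Finset.mul_sum, sq, mul_inv]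
        ring

/-- Second moment of a weighted sum of independent centered variables with a common law. -/
lemma integral_sum_mul_sq [IsProbabilityMeasure P] {η : ℕ → Ω → ℝ} (hi : iIndepFun η P)
    (hd : ∀ t, IdentDistrib (η t) (η 0) P P) (hL : MemLp (η 0) 2 P)
    (h0 : ∫ ω, η 0 ω ∂P = 0) {n : ℕ} (a : Fin n → ℝ) :
    Integrable (fun ω => (∑ t : Fin n, a t * η t ω) ^ 2) P ∧
    ∫ ω, (∑ t : Fin n, a t * η t ω) ^ 2 ∂P = (∑ t, a t ^ 2) * ∫ ω, η 0 ω ^ 2 ∂P := by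
  have hLt : ∀ t : Fin n, MemLp (fun ω => a t * η t ω) 2 P := fun t =>
    ((hd t).memLp_iff.mpr hL).const_mul (a t)
  have hsumL : MemLp (fun ω => ∑ t : Fin n, a t * η t ω) 2 P :=
    memLp_finsetSum _ fun t _ => hLt t
  refine ⟨(memLp_two_iff_integrable_sq hsumL.aestronglyMeasurable).mp hsumL, ?_⟩
  have h0t : ∀ t : Fin n, ∫ ω, a t * η t ω ∂P = 0 := fun t => by
    rw [integral_const_mul, (hd t).integral_eq, h0, mul_zero]
  have hpair : ((Finset.univ : Finset (Fin n)) : Set (Fin n)).Pairwise fun i j =>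
      (fun ω => a i * η i ω) ⟂ᵢ[P] (fun ω => a j * η j ω) := by
    intro i _ j _ hij
    have hij' : (i : ℕ) ≠ j := fun h => hij (Fin.ext h)
    exact (hi.indepFun hij').comp (φ := fun y => a i * y) (ψ := fun y => a j * y)
      (by fun_prop) (by fun_prop)
  have hvar := IndepFun.variance_sum (X := fun (t : Fin n) ω => a t * η t ω)
    (fun t _ => hLt t) hpair
  have hfun : (∑ t : Fin n, fun ω => a t * η t ω) = fun ω => ∑ t : Fin n, a t * η t ω := by
    ext ω
    simp
  have hz : ∫ ω, ∑ t : Fin n, a t * η t ω ∂P = 0 := by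
    rw [integral_finsetSum _ fun t _ => (hLt t).integrable one_le_two]
    exact Finset.sum_eq_zero fun t _ => h0t t
  rw [hfun, variance_of_integral_eq_zero hsumL.aestronglyMeasurable.aemeasurable hz] at hvar
  rw [hvar, Finset.sum_mul]
  refine Finset.sum_congr rfl fun t _ => ?_
  rw [variance_of_integral_eq_zero (hLt t).aestronglyMeasurable.aemeasurable (h0t t)]
  simp only [mul_pow]
  rw [integral_const_mul]
  congr 1
  exact ((hd t).comp (u := fun y : ℝ => y ^ 2) (by fun_prop)).integral_eq

lemma RidgeBase.integral_sq [IsProbabilityMeasure P]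
    (H : RidgeBase P x ε c sigma2 c₀ Sig) : ∫ ω, ε 0 ω ^ 2 ∂P = sigma2 := by
  rw [← H.variance_eq, variance_of_integral_eq_zero (H.measurable_err 0).aemeasurable H.mean_zero]

lemma RidgeBase.integral_score_sq [IsProbabilityMeasure P] (H : RidgeBase P x ε c sigma2 c₀ Sig)
    (n : ℕ) (a : Fin p) :
    Integrable (fun ω => (√(n : ℝ) * Sxy (xData x n) (errData ε n ω) a) ^ 2) P ∧
    ∫ ω, (√(n : ℝ) * Sxy (xData x n) (errData ε n ω) a) ^ 2 ∂P =
      sigma2 * Sxx (xData x n) a a := by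
  have h := integral_sum_mul_sq H.indep H.identDistrib H.memLp_two H.mean_zero
    fun t : Fin n => √(n : ℝ) * (n : ℝ)⁻¹ * xData x n t a
  have heq : ∀ ω, ∑ t : Fin n, √(n : ℝ) * (n : ℝ)⁻¹ * xData x n t a * ε t ω =
      √(n : ℝ) * Sxy (xData x n) (errData ε n ω) a := by
    intro ω
    simp only [Sxy, errData, Pi.smul_apply, Finset.sum_apply, smul_eq_mul, Finset.mul_sum]
    refine Finset.sum_congr rfl fun t _ => ?_
    ring
  simp only [heq, H.integral_sq] at h
  refine ⟨h.1, h.2.trans ?_⟩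
  rw [mul_comm, Sxx_apply]
  congr 1
  simp only [mul_pow, Real.sq_sqrt (Nat.cast_nonneg n), ← Finset.mul_sum]
  rcases Nat.eq_zero_or_pos n with rfl | hn
  · simp
  · have hn' : (n : ℝ) ≠ 0 := by positivity
    congr 1
    · field_simp
    · exact Finset.sum_congr rfl fun t _ => sq _

/-- `√n (θ̂ - θ)` is bounded in probability, so it vanishes after multiplication by the square root
of the normalized fourth moment of the regressors. -/
lemma RidgeBase.tendsto_ols_sub_theta [IsProbabilityMeasure P]
    (H : RidgeBase P x ε c sigma2 c₀ Sig)
    (h4 : Tendsto (fun n => fourthMoment (xData x n)) atTop (𝓝 0)) (δ : Fin p → ℝ) :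
    Tendsto (fun z : Σ _ : ℕ, Ω => (√(fourthMoment (xData x z.1)) * √(z.1 : ℝ)) •
      (ols (xData x z.1) (yData x δ ε z.1 z.2) - theta δ z.1))
      (probFilter atTop fun _ => P) (𝓝 0) := by
  have hfst : Tendsto Sigma.fst (probFilter (atTop : Filter ℕ) fun _ => P) atTop :=
    tendsto_fst_probFilter
  have hs4 : Tendsto (fun n => √(fourthMoment (xData x n))) atTop (𝓝 0) := by
    have := (Real.continuous_sqrt.tendsto 0).comp h4
    rwa [Real.sqrt_zero] at this
  have hU : Tendsto (fun z : Σ _ : ℕ, Ω => (√(fourthMoment (xData x z.1)) * √(z.1 : ℝ)) •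
      Sxy (xData x z.1) (errData ε z.1 z.2)) (probFilter atTop fun _ => P) (𝓝 0) := by
    rw [tendsto_pi_nhds]
    intro a
    have h := tendsto_probFilter_mul_of_integral_sq_le (C := sigma2 * (Sig a a + 1))
      (X := fun z : Σ _ : ℕ, Ω => √(fourthMoment (xData x z.1)))
      (W := fun z : Σ _ : ℕ, Ω => √(z.1 : ℝ) * Sxy (xData x z.1) (errData ε z.1 z.2) a)
      (μ := fun _ : ℕ => P) (hs4.comp hfst)
      (Eventually.of_forall fun n => (H.integral_score_sq n a).1) (by
        filter_upwards [(tendsto_matrix_iff.mp H.tendsto_Sxx a a).eventually_le_const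
          (lt_add_one _)] with n hn
        rw [(H.integral_score_sq n a).2]
        exact mul_le_mul_of_nonneg_left hn H.sigma2_pos.le)
    refine h.congr fun z => ?_
    rw [Pi.smul_apply, smul_eq_mul]
    ring
  have h := tendsto_mulVec ((tendsto_matrix_inv H.tendsto_Sxx H.posDef).comp hfst) hU
  rw [mulVec_zero] at h
  refine h.congr' ?_
  filter_upwards [hfst.eventually (eventually_isUnit_det H.tendsto_Sxx H.posDef)] with z hz
  rw [ols_sub_theta hz, Function.comp_apply, mulVec_smul]

lemma tendsto_dotProduct_self {ι : Type*} {l : Filter ι} {u : ι → Fin p → ℝ}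
    (hu : Tendsto u l (𝓝 0)) : Tendsto (fun i => u i ⬝ᵥ u i) l (𝓝 0) := by
  simpa using tendsto_dotProduct hu hu

lemma RidgeBase.tendsto_ols_sub_theta_sq [IsProbabilityMeasure P]
    (H : RidgeBase P x ε c sigma2 c₀ Sig)
    (h4 : Tendsto (fun n => fourthMoment (xData x n)) atTop (𝓝 0)) (δ : Fin p → ℝ) :
    Tendsto (fun z : Σ _ : ℕ, Ω => z.1 * fourthMoment (xData x z.1) *
      ((ols (xData x z.1) (yData x δ ε z.1 z.2) - theta δ z.1) ⬝ᵥ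
        (ols (xData x z.1) (yData x δ ε z.1 z.2) - theta δ z.1)))
      (probFilter atTop fun _ => P) (𝓝 0) := by
  refine (tendsto_dotProduct_self (H.tendsto_ols_sub_theta h4 δ)).congr fun z => ?_
  rw [smul_dotProduct, dotProduct_smul, smul_eq_mul, smul_eq_mul, ← mul_assoc]
  congr 1
  rw [mul_mul_mul_comm, Real.mul_self_sqrt (fourthMoment_nonneg _),
    Real.mul_self_sqrt (Nat.cast_nonneg _), mul_comm]

/-- As `√n θ = δ` is fixed, `√n θ̂` is bounded in probability, which makes the effect of
resampling `S_xx` on the ridge bias negligible. -/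
lemma RidgeBase.tendsto_ols_sq [IsProbabilityMeasure P] (H : RidgeBase P x ε c sigma2 c₀ Sig)
    (h4 : Tendsto (fun n => fourthMoment (xData x n)) atTop (𝓝 0)) (δ : Fin p → ℝ) :
    Tendsto (fun z : Σ _ : ℕ, Ω => z.1 * fourthMoment (xData x z.1) *
      (ols (xData x z.1) (yData x δ ε z.1 z.2) ⬝ᵥ ols (xData x z.1) (yData x δ ε z.1 z.2)))
      (probFilter atTop fun _ => P) (𝓝 0) := by
  have hfst : Tendsto Sigma.fst (probFilter (atTop : Filter ℕ) fun _ => P) atTop :=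
    tendsto_fst_probFilter
  have hs4 : Tendsto (fun n => √(fourthMoment (xData x n))) atTop (𝓝 0) := by
    have := (Real.continuous_sqrt.tendsto 0).comp h4
    rwa [Real.sqrt_zero] at this
  have h1 := (H.tendsto_ols_sub_theta h4 δ).add ((hs4.smul_const δ).comp hfst)
  rw [zero_smul, add_zero] at h1
  refine (tendsto_dotProduct_self h1).congr' ?_
  filter_upwards [hfst.eventually (eventually_ge_atTop 1)] with z hz
  have hn : (0 : ℝ) < z.1 := Nat.cast_pos.mpr hz
  have h2 : √(fourthMoment (xData x z.1)) • δ =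
      (√(fourthMoment (xData x z.1)) * √(z.1 : ℝ)) • theta δ z.1 := by
    rw [theta, smul_smul, mul_assoc, mul_inv_cancel₀ (Real.sqrt_pos.mpr hn).ne', mul_one]
  rw [Function.comp_apply, h2, ← smul_add, sub_add_cancel, smul_dotProduct, dotProduct_smul,
    smul_eq_mul, smul_eq_mul, ← mul_assoc]
  congr 1
  rw [mul_mul_mul_comm, Real.mul_self_sqrt (fourthMoment_nonneg _),
    Real.mul_self_sqrt (Nat.cast_nonneg _), mul_comm]

/-- Law of large numbers for the squared errors weighted by products of regressors. -/
lemma RidgeBase.tendsto_err_sq [IsProbabilityMeasure P] (H : RidgeBase P x ε c sigma2 c₀ Sig)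
    (h4 : Tendsto (fun n => fourthMoment (xData x n)) atTop (𝓝 0))
    (hm : Integrable (fun ω => ε 0 ω ^ 4) P) (a b : Fin p) :
    Tendsto (fun z : Σ _ : ℕ, Ω => (z.1 : ℝ)⁻¹ *
      ∑ t : Fin z.1, ε t z.2 ^ 2 * (xData x z.1 t a * xData x z.1 t b))
      (probFilter atTop fun _ => P) (𝓝 (sigma2 * Sig a b)) := by
  have hfst : Tendsto Sigma.fst (probFilter (atTop : Filter ℕ) fun _ => P) atTop :=
    tendsto_fst_probFilter
  set η : ℕ → Ω → ℝ := fun t ω => ε t ω ^ 2 - sigma2 with hη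
  have hηi : iIndepFun η P := H.indep.comp (fun _ y => y ^ 2 - sigma2) (by fun_prop)
  have hηd : ∀ t, IdentDistrib (η t) (η 0) P P := fun t =>
    (H.identDistrib t).comp (u := fun y => y ^ 2 - sigma2) (by fun_prop)
  have hηL : MemLp (η 0) 2 P := by
    refine MemLp.sub ?_ (memLp_const _)
    refine (memLp_two_iff_integrable_sq
      ((H.measurable_err 0).pow_const 2).aestronglyMeasurable).mpr ?_
    simpa only [← pow_mul] using hm
  have hη0 : ∫ ω, η 0 ω ∂P = 0 := by
    have hint : Integrable (fun ω => ε 0 ω ^ 2) P := H.memLp_two.integrable_sq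
    simp only [hη]
    rw [integral_sub hint (integrable_const _), H.integral_sq]
    simp
  have h1 : Tendsto (fun z : Σ _ : ℕ, Ω => ∑ t : Fin z.1,
      ((z.1 : ℝ)⁻¹ * (xData x z.1 t a * xData x z.1 t b)) * η t z.2)
      (probFilter atTop fun _ => P) (𝓝 0) := by
    have hI := fun n : ℕ => integral_sum_mul_sq hηi hηd hηL hη0
      fun t : Fin n => (n : ℝ)⁻¹ * (xData x n t a * xData x n t b)
    refine tendsto_probFilter_of_integral_sq (Eventually.of_forall fun n => (hI n).1) ?_
    have hlim := h4.mul_const (∫ ω, η 0 ω ^ 2 ∂P)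
    rw [zero_mul] at hlim
    refine squeeze_zero (fun n => integral_nonneg fun _ => sq_nonneg _) (fun n => ?_) hlim
    rw [(hI n).2]
    refine mul_le_mul_of_nonneg_right ?_ (integral_nonneg fun _ => sq_nonneg _)
    rw [fourthMoment, Finset.mul_sum]
    refine Finset.sum_le_sum fun t _ => ?_
    rw [mul_pow, inv_pow, mul_pow, sq (_ ⬝ᵥ _)]
    gcongr
    · exact dotProduct_self_nonneg_real _
    · exact sq_apply_le_dotProduct_self _ _
    · exact sq_apply_le_dotProduct_self _ _
  have h2 : Tendsto (fun z : Σ _ : ℕ, Ω => sigma2 * Sxx (xData x z.1) a b)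
      (probFilter atTop fun _ => P) (𝓝 (sigma2 * Sig a b)) :=
    ((tendsto_matrix_iff.mp H.tendsto_Sxx a b).const_mul sigma2).comp hfst
  have h3 := h1.add h2
  rw [zero_add] at h3
  refine h3.congr fun z => ?_
  rw [Sxx_apply, Finset.mul_sum, Finset.mul_sum, Finset.mul_sum, ← Finset.sum_add_distrib]
  refine Finset.sum_congr rfl fun t _ => ?_
  simp only [hη]
  ring

lemma RidgeBase.tendsto_err_fourth [IsProbabilityMeasure P] (H : RidgeBase P x ε c sigma2 c₀ Sig)
    (h4 : Tendsto (fun n => fourthMoment (xData x n)) atTop (𝓝 0))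
    (hm : Integrable (fun ω => ε 0 ω ^ 4) P) :
    Tendsto (fun z : Σ _ : ℕ, Ω => ((z.1 : ℝ) ^ 2)⁻¹ *
      ∑ t : Fin z.1, ε t z.2 ^ 4 * (xData x z.1 t ⬝ᵥ xData x z.1 t) ^ 2)
      (probFilter atTop fun _ => P) (𝓝 0) := by
  have hd : ∀ t, IdentDistrib (fun ω => ε t ω ^ 4) (fun ω => ε 0 ω ^ 4) P P := fun t =>
    (H.identDistrib t).comp (u := fun y : ℝ => y ^ 4) (by fun_prop)
  have hmt : ∀ t, Integrable (fun ω => ε t ω ^ 4) P := fun t =>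
    (hd t).integrable_iff.mpr hm
  have hint : ∀ n : ℕ, Integrable (fun ω => ((n : ℝ) ^ 2)⁻¹ *
      ∑ t : Fin n, ε t ω ^ 4 * (xData x n t ⬝ᵥ xData x n t) ^ 2) P := fun n =>
    (integrable_finsetSum Finset.univ fun (t : Fin n) _ => (hmt t).mul_const _).const_mul _
  refine tendsto_probFilter_of_integral (fun z => by positivity)
    (Eventually.of_forall hint) ?_
  have hlim := h4.const_mul (∫ ω, ε 0 ω ^ 4 ∂P)
  rw [mul_zero] at hlim
  refine hlim.congr fun n => ?_
  dsimp only
  rw [integral_const_mul, integral_finsetSum Finset.univ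
    fun (t : Fin n) _ => (hmt t).mul_const ((xData x n t ⬝ᵥ xData x n t) ^ 2), fourthMoment,
    mul_left_comm, Finset.mul_sum]
  congr 1
  refine Finset.sum_congr rfl fun t _ => ?_
  rw [integral_mul_const, (hd t).integral_eq]

/-- Replacing the errors by the residuals changes weighted second moments by a negligible
amount. -/
lemma RidgeBase.tendsto_resid_sq [IsProbabilityMeasure P] (H : RidgeBase P x ε c sigma2 c₀ Sig)
    (h4 : Tendsto (fun n => fourthMoment (xData x n)) atTop (𝓝 0))
    (hm : Integrable (fun ω => ε 0 ω ^ 4) P) (δ : Fin p → ℝ) (a b : Fin p) :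
    Tendsto (fun z : Σ _ : ℕ, Ω => (z.1 : ℝ)⁻¹ *
      ∑ t, resid (xData x z.1) (yData x δ ε z.1 z.2) t ^ 2 *
        (xData x z.1 t a * xData x z.1 t b))
      (probFilter atTop fun _ => P) (𝓝 (sigma2 * Sig a b)) := by
  have hA : Tendsto (fun z : Σ _ : ℕ, Ω => (z.1 : ℝ)⁻¹ *
      ∑ t : Fin z.1, ε t z.2 ^ 2 * (xData x z.1 t ⬝ᵥ xData x z.1 t))
      (probFilter atTop fun _ => P) (𝓝 (∑ a, sigma2 * Sig a a)) :=
    (tendsto_finsetSum _ fun a _ => H.tendsto_err_sq h4 hm a a).congr fun z =>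
      (sum_dotProduct_self_eq (xData x z.1) fun t => ε t z.2 ^ 2).symm
  have hR := H.tendsto_ols_sub_theta_sq h4 δ
  have hbound := (((Real.continuous_sqrt.tendsto _).comp (hA.mul hR)).const_mul 2).add hR
  simp only [mul_zero, Real.sqrt_zero, add_zero] at hbound
  rw [← tendsto_sub_nhds_zero_iff]
  have hE := H.tendsto_err_sq h4 hm a b
  rw [← tendsto_sub_nhds_zero_iff] at hE
  suffices hdiff : Tendsto (fun z : Σ _ : ℕ, Ω => (z.1 : ℝ)⁻¹ *
      ∑ t, resid (xData x z.1) (yData x δ ε z.1 z.2) t ^ 2 *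
        (xData x z.1 t a * xData x z.1 t b) - (z.1 : ℝ)⁻¹ *
      ∑ t : Fin z.1, ε t z.2 ^ 2 * (xData x z.1 t a * xData x z.1 t b))
      (probFilter atTop fun _ => P) (𝓝 0) by
    have := hdiff.add hE
    rw [add_zero] at this
    refine this.congr fun z => ?_
    ring
  refine squeeze_zero_norm (fun z => ?_) hbound
  obtain ⟨n, ω⟩ := z
  dsimp only
  set X := xData x n with hX
  set d := ols X (yData x δ ε n ω) - theta δ n with hd
  set r : Fin n → ℝ := fun t => X t ⬝ᵥ X t with hr
  have hr0 : ∀ t, 0 ≤ r t := fun t => dotProduct_self_nonneg_real _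
  set R := (n : ℝ) * fourthMoment X * (d ⬝ᵥ d) with hRdef
  set A := (n : ℝ)⁻¹ * ∑ t : Fin n, ε t ω ^ 2 * r t with hAdef
  have hn0 : (0 : ℝ) ≤ (n : ℝ)⁻¹ := by positivity
  have hR2 : (n : ℝ)⁻¹ * ∑ t, (d ⬝ᵥ X t) ^ 2 * r t ≤ R := by
    calc _ ≤ (n : ℝ)⁻¹ * ∑ t, ((d ⬝ᵥ d) * r t) * r t := by
          refine mul_le_mul_of_nonneg_left (Finset.sum_le_sum fun t _ => ?_) hn0
          exact mul_le_mul_of_nonneg_right (sq_dotProduct_le d (X t)) (hr0 t)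
      _ = R := by
          rw [hRdef, fourthMoment]
          have : ∑ t, (d ⬝ᵥ d) * r t * r t = (d ⬝ᵥ d) * ∑ t, (X t ⬝ᵥ X t) ^ 2 := by
            rw [Finset.mul_sum]
            refine Finset.sum_congr rfl fun t _ => ?_
            rw [hr]
            ring
          rw [this]
          rcases Nat.eq_zero_or_pos n with rfl | hn
          · simp
          · have : (n : ℝ) ≠ 0 := by positivity
            field_simp
  -- Cauchy–Schwarz for the cross term
  have hcross : (n : ℝ)⁻¹ * ∑ t : Fin n, |ε t ω * (d ⬝ᵥ X t)| * r t ≤ √(A * R) := by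
    refine Real.le_sqrt_of_sq_le ?_
    have hcs := Finset.sum_mul_sq_le_sq_mul_sq (Finset.univ : Finset (Fin n))
      (fun t => |ε t ω| * √(r t)) (fun t => |d ⬝ᵥ X t| * √(r t))
    have e1 : ∀ t : Fin n, |ε t ω| * √(r t) * (|d ⬝ᵥ X t| * √(r t)) =
        |ε t ω * (d ⬝ᵥ X t)| * r t := fun t => by
      rw [mul_mul_mul_comm, Real.mul_self_sqrt (hr0 t), abs_mul]
    simp only [e1, mul_pow, sq_abs, Real.sq_sqrt (hr0 _)] at hcs
    calc _ = (n : ℝ)⁻¹ ^ 2 * (∑ t : Fin n, |ε t ω * (d ⬝ᵥ X t)| * r t) ^ 2 := by rw [mul_pow]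
      _ ≤ (n : ℝ)⁻¹ ^ 2 * ((∑ t : Fin n, ε t ω ^ 2 * r t) * ∑ t, (d ⬝ᵥ X t) ^ 2 * r t) := by
          gcongr
      _ = A * ((n : ℝ)⁻¹ * ∑ t, (d ⬝ᵥ X t) ^ 2 * r t) := by rw [hAdef]; ring
      _ ≤ A * R := by
          refine mul_le_mul_of_nonneg_left hR2 (mul_nonneg hn0 (Finset.sum_nonneg fun t _ => ?_))
          exact mul_nonneg (sq_nonneg _) (hr0 t)
  rw [← mul_sub, ← Finset.sum_sub_distrib, Real.norm_eq_abs, abs_mul, abs_of_nonneg hn0]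
  have hpt : ∀ t : Fin n, |resid X (yData x δ ε n ω) t ^ 2 * (X t a * X t b) -
      ε t ω ^ 2 * (X t a * X t b)| ≤
        2 * (|ε t ω * (d ⬝ᵥ X t)| * r t) + (d ⬝ᵥ X t) ^ 2 * r t := by
    intro t
    have hab : |X t a * X t b| ≤ r t := by
      have h1 := sq_apply_le_dotProduct_self (X t) a
      have h2 := sq_apply_le_dotProduct_self (X t) b
      rw [abs_le]
      constructor <;> nlinarith [sq_nonneg (X t a - X t b), sq_nonneg (X t a + X t b)]
    rw [resid_yData, ← hX, ← hd]
    have e : (ε t ω - d ⬝ᵥ X t) ^ 2 * (X t a * X t b) - ε t ω ^ 2 * (X t a * X t b) =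
        (-(2 * (ε t ω * (d ⬝ᵥ X t))) + (d ⬝ᵥ X t) ^ 2) * (X t a * X t b) := by ring
    rw [e, abs_mul]
    calc _ ≤ (2 * |ε t ω * (d ⬝ᵥ X t)| + (d ⬝ᵥ X t) ^ 2) * r t := by
          refine mul_le_mul ?_ hab (abs_nonneg _) (by positivity)
          refine (abs_add_le _ _).trans (le_of_eq ?_)
          rw [abs_neg, abs_mul, abs_two, abs_of_nonneg (sq_nonneg (d ⬝ᵥ X t))]
      _ = _ := by ring
  calc _ ≤ (n : ℝ)⁻¹ * ∑ t : Fin n,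
          (2 * (|ε t ω * (d ⬝ᵥ X t)| * r t) + (d ⬝ᵥ X t) ^ 2 * r t) := by
        refine mul_le_mul_of_nonneg_left ?_ hn0
        exact (Finset.abs_sum_le_sum_abs _ _).trans (Finset.sum_le_sum fun t _ => hpt t)
    _ = 2 * ((n : ℝ)⁻¹ * ∑ t : Fin n, |ε t ω * (d ⬝ᵥ X t)| * r t) +
          (n : ℝ)⁻¹ * ∑ t, (d ⬝ᵥ X t) ^ 2 * r t := by
        rw [Finset.sum_add_distrib, ← Finset.mul_sum]
        ring
    _ ≤ 2 * √(A * R) + R := by gcongr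

/-- Lyapunov condition for the bootstrap sample: the fourth moments of the scores `x ê` are
negligible. -/
lemma RidgeBase.tendsto_resid_fourth [IsProbabilityMeasure P]
    (H : RidgeBase P x ε c sigma2 c₀ Sig)
    (h4 : Tendsto (fun n => fourthMoment (xData x n)) atTop (𝓝 0))
    (hm : Integrable (fun ω => ε 0 ω ^ 4) P) (δ : Fin p → ℝ) :
    Tendsto (fun z : Σ _ : ℕ, Ω => ((z.1 : ℝ) ^ 2)⁻¹ *
      ∑ t, resid (xData x z.1) (yData x δ ε z.1 z.2) t ^ 4 *
        (xData x z.1 t ⬝ᵥ xData x z.1 t) ^ 2)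
      (probFilter atTop fun _ => P) (𝓝 0) := by
  have hR := H.tendsto_ols_sub_theta_sq h4 δ
  have hbound := ((H.tendsto_err_fourth h4 hm).const_mul 8).add ((hR.pow 2).const_mul 8)
  simp only [mul_zero, add_zero, ne_eq, OfNat.ofNat_ne_zero, not_false_eq_true, zero_pow] at hbound
  refine squeeze_zero (fun z => by positivity) (fun z => ?_) hbound
  obtain ⟨n, ω⟩ := z
  dsimp only
  set X := xData x n with hX
  set d := ols X (yData x δ ε n ω) - theta δ n with hd
  have hpt : ∀ t : Fin n, resid X (yData x δ ε n ω) t ^ 4 * (X t ⬝ᵥ X t) ^ 2 ≤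
      8 * (ε t ω ^ 4 * (X t ⬝ᵥ X t) ^ 2) + 8 * (d ⬝ᵥ d) ^ 2 * ((X t ⬝ᵥ X t) ^ 2) ^ 2 := by
    intro t
    rw [resid_yData, ← hX, ← hd]
    have h1 : (ε t ω - d ⬝ᵥ X t) ^ 4 ≤ 8 * ε t ω ^ 4 + 8 * ((d ⬝ᵥ X t) ^ 2) ^ 2 := by
      nlinarith [sq_nonneg (ε t ω ^ 2 - (d ⬝ᵥ X t) ^ 2), sq_nonneg (ε t ω + d ⬝ᵥ X t),
        sq_nonneg ((ε t ω + d ⬝ᵥ X t) ^ 2), sq_nonneg ((ε t ω - d ⬝ᵥ X t) ^ 2),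
        mul_nonneg (sq_nonneg (ε t ω + d ⬝ᵥ X t)) (sq_nonneg (ε t ω - d ⬝ᵥ X t))]
    have h2 : ((d ⬝ᵥ X t) ^ 2) ^ 2 ≤ ((d ⬝ᵥ d) * (X t ⬝ᵥ X t)) ^ 2 :=
      pow_le_pow_left₀ (sq_nonneg _) (sq_dotProduct_le d (X t)) 2
    calc _ ≤ (8 * ε t ω ^ 4 + 8 * ((d ⬝ᵥ d) * (X t ⬝ᵥ X t)) ^ 2) * (X t ⬝ᵥ X t) ^ 2 := by
          refine mul_le_mul_of_nonneg_right (h1.trans ?_) (sq_nonneg _)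
          linarith
      _ = _ := by ring
  -- the sum of the squares of nonnegative numbers is at most the square of their sum
  have hss : ∑ t, ((X t ⬝ᵥ X t) ^ 2) ^ 2 ≤ (∑ t, (X t ⬝ᵥ X t) ^ 2) ^ 2 :=
    Finset.sum_sq_le_sq_sum_of_nonneg fun t _ => sq_nonneg _
  calc _ ≤ ((n : ℝ) ^ 2)⁻¹ * ∑ t : Fin n, (8 * (ε t ω ^ 4 * (X t ⬝ᵥ X t) ^ 2) +
          8 * (d ⬝ᵥ d) ^ 2 * ((X t ⬝ᵥ X t) ^ 2) ^ 2) := by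
        gcongr with t
        exact hpt t
    _ = 8 * (((n : ℝ) ^ 2)⁻¹ * ∑ t : Fin n, ε t ω ^ 4 * (X t ⬝ᵥ X t) ^ 2) +
          8 * ((d ⬝ᵥ d) ^ 2 * (((n : ℝ) ^ 2)⁻¹ * ∑ t, ((X t ⬝ᵥ X t) ^ 2) ^ 2)) := by
        rw [Finset.sum_add_distrib, ← Finset.mul_sum, ← Finset.mul_sum]
        ring
    _ ≤ 8 * (((n : ℝ) ^ 2)⁻¹ * ∑ t : Fin n, ε t ω ^ 4 * (X t ⬝ᵥ X t) ^ 2) +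
          8 * ((d ⬝ᵥ d) ^ 2 * (((n : ℝ) ^ 2)⁻¹ * (∑ t, (X t ⬝ᵥ X t) ^ 2) ^ 2)) := by gcongr
    _ = _ := by
        congr 2
        rw [fourthMoment]
        rcases Nat.eq_zero_or_pos n with rfl | hn
        · simp
        · have : (n : ℝ) ≠ 0 := by positivity
          field_simp

end DataLimits


/-! ### Distribution functions of the Gaussian limit -/

section GaussianLimit

variable {Ω' : Type*} [MeasurableSpace Ω'] {P' : Measure Ω'}
  {ξ₁ ξ₂ ξ : Ω' → ℝ} {W : Matrix (Fin 2) (Fin 2) ℝ}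

/-- Cramér–Wold device: the characteristic function of a pair is that of its linear
combinations. -/
lemma charFun_map_pair {A B : Ω' → ℝ} (hA : AEMeasurable A P') (hB : AEMeasurable B P')
    (s : EuclideanSpace ℝ (Fin 2)) (t : ℝ) :
    charFun (P'.map fun ω => !₂[A ω, B ω]) (t • s) =
      charFun (P'.map fun ω => s 0 * A ω + s 1 * B ω) t := by
  have hm : AEMeasurable (fun ω => !₂[A ω, B ω]) P' := by
    refine (WithLp.measurable_toLp 2 _).comp_aemeasurable ?_
    refine aemeasurable_pi_lambda _ fun i => ?_
    fin_cases i
    · exact hA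
    · exact hB
  have hl : AEMeasurable (fun ω => s 0 * A ω + s 1 * B ω) P' :=
    (hA.const_mul _).add (hB.const_mul _)
  rw [charFun_apply, charFun_apply_real, integral_map hm (by fun_prop),
    integral_map hl (by fun_prop)]
  congr 1
  ext ω
  congr 2
  simp [PiLp.inner_apply, Fin.sum_univ_two]
  ring

lemma aemeasurable_of_hasLaw_pair
    (hξ : HasLaw (fun ω' => !₂[ξ₁ ω', ξ₂ ω']) (multivariateGaussian 0 W) P') :
    AEMeasurable ξ₁ P' ∧ AEMeasurable ξ₂ P' := by
  have h : ∀ i : Fin 2, Measurable fun e : EuclideanSpace ℝ (Fin 2) => e i :=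
    fun i => by fun_prop
  exact ⟨(h 0).comp_aemeasurable hξ.aemeasurable, (h 1).comp_aemeasurable hξ.aemeasurable⟩

lemma hasLaw_linear_combination [IsProbabilityMeasure P'] (hW : W.PosSemidef)
    (hξ : HasLaw (fun ω' => !₂[ξ₁ ω', ξ₂ ω']) (multivariateGaussian 0 W) P') (s : Fin 2 → ℝ) :
    HasLaw (fun ω' => s 0 * ξ₁ ω' + s 1 * ξ₂ ω') (gaussianReal 0 (s ⬝ᵥ W *ᵥ s).toNNReal) P' := by
  obtain ⟨h1, h2⟩ := aemeasurable_of_hasLaw_pair hξ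
  have hm : AEMeasurable (fun ω' => s 0 * ξ₁ ω' + s 1 * ξ₂ ω') P' :=
    (h1.const_mul _).add (h2.const_mul _)
  refine ⟨hm, ?_⟩
  have := Measure.isProbabilityMeasure_map hm
  refine Measure.ext_of_charFun ?_
  ext t
  have h := charFun_map_pair h1 h2 (WithLp.toLp 2 s) t
  simp only at h
  rw [← h, hξ.map_eq, charFun_multivariateGaussian hW, charFun_gaussianReal]
  have hnn : 0 ≤ s ⬝ᵥ W *ᵥ s := by simpa using hW.dotProduct_mulVec_nonneg s
  rw [Real.coe_toNNReal _ hnn]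
  congr 1
  simp only [WithLp.ofLp_smul, smul_dotProduct, mulVec_smul, dotProduct_smul, smul_eq_mul]
  simp
  ring

lemma distFun_eq_of_hasLaw {v : NNReal} (h : HasLaw ξ (gaussianReal 0 v) P') (u : ℝ) :
    distFun P' ξ u = (gaussianReal 0 v).real (Set.Iic u) :=
  h.measureReal_eq (p := fun y => y ≤ u) measurableSet_Iic

lemma centeredAtZero_of_hasLaw {v : NNReal} (h : HasLaw ξ (gaussianReal 0 v) P') :
    CenteredAtZero P' ξ := by
  constructor
  · have hi : Integrable id (gaussianReal 0 v) := IsGaussian.integrable_id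
    rw [← h.map_eq] at hi
    exact hi.comp_aemeasurable h.aemeasurable
  · have := h.integral_comp (f := id) aestronglyMeasurable_id
    simpa using this

lemma continuous_measureReal_Iic (μ : Measure ℝ) [IsProbabilityMeasure μ]
    [NullSingletonClass μ] : Continuous fun u => μ.real (Set.Iic u) := by
  simp_rw [← cdf_eq_real]
  refine continuous_iff_continuousAt.mpr fun u => ?_
  have hmono := monotone_cdf μ
  rw [hmono.continuousAt_iff_leftLim_eq_rightLim, (cdf μ).rightLim_eq]
  have h := (cdf μ).measure_singleton u
  rw [measure_cdf, measure_singleton, eq_comm, ENNReal.ofReal_eq_zero, sub_nonpos] at h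
  exact le_antisymm (hmono.leftLim_le le_rfl) h

lemma continuous_distFun_of_hasLaw {v : NNReal} (hv : v ≠ 0)
    (h : HasLaw ξ (gaussianReal 0 v) P') : Continuous (distFun P' ξ) := by
  have := nullSingletonClass_gaussianReal (μ := 0) hv
  rw [funext (distFun_eq_of_hasLaw h)]
  exact continuous_measureReal_Iic _

lemma strictMono_distFun_of_hasLaw {v : NNReal} (hv : v ≠ 0)
    (h : HasLaw ξ (gaussianReal 0 v) P') : StrictMono (distFun P' ξ) := by
  intro a b hab
  rw [distFun_eq_of_hasLaw h, distFun_eq_of_hasLaw h]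
  have hpos : 0 < gaussianReal 0 v (Set.Ioc a b) := by
    refine pos_iff_ne_zero.mpr fun h0 => ?_
    have := gaussianReal_absolutelyContinuous' 0 hv h0
    simp [hab.not_ge] at this
  have hreal : 0 < (gaussianReal 0 v).real (Set.Ioc a b) :=
    ENNReal.toReal_pos hpos.ne' (measure_ne_top _ _)
  rw [← Set.Iic_union_Ioc_eq_Iic hab.le,
    measureReal_union (Set.Iic_disjoint_Ioc le_rfl) measurableSet_Ioc]
  linarith

end GaussianLimit

/-! ### Limits of the statistic, of the bias estimate and of the bootstrap -/

section SampleLimit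

variable {Ω : Type*} {p : ℕ} {x : ℕ → Fin p → ℝ} {δ : Fin p → ℝ} {ε : ℕ → Ω → ℝ} {c : ℕ → ℝ}
  {g : Fin p → ℝ} {r : ℕ → ℝ} {n : ℕ}

/-- Under the null hypothesis, the centered statistic is linear in the errors. -/
lemma Tstat_sub_Bias (hn : 0 < n) (hnull : g ⬝ᵥ theta δ n = r n)
    (hA : IsUnit (SxxRidge (c n) (xData x n)).det) (ω : Ω) :
    Tstat x δ ε c g r n ω - Bias x δ c g n = √(n : ℝ) *
      (g ⬝ᵥ (SxxRidge (c n) (xData x n))⁻¹ *ᵥ Sxy (xData x n) (errData ε n ω)) := by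
  set A := SxxRidge (c n) (xData x n) with hAdef
  set e := Sxy (xData x n) (errData ε n ω) with he
  have hSA : Sxx (xData x n) *ᵥ theta δ n =
      A *ᵥ theta δ n - ((n : ℝ)⁻¹ * c n) • theta δ n := by
    rw [hAdef, SxxRidge, add_mulVec, smul_mulVec, one_mulVec, add_sub_cancel_right]
  have hinv : A⁻¹ *ᵥ (A *ᵥ theta δ n) = theta δ n := by
    rw [mulVec_mulVec, nonsing_inv_mul _ hA, one_mulVec]
  have hr : ridge (c n) (xData x n) (yData x δ ε n ω) =
      theta δ n - ((n : ℝ)⁻¹ * c n) • (A⁻¹ *ᵥ theta δ n) + A⁻¹ *ᵥ e := by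
    rw [ridge, Sxy_yData, ← he, hSA, ← hAdef, mulVec_add, mulVec_sub, hinv, mulVec_smul]
  rw [Tstat, Bias, hr, ← hnull, ← hAdef]
  simp only [dotProduct_add, dotProduct_sub, dotProduct_smul, smul_eq_mul]
  linear_combination (-(g ⬝ᵥ A⁻¹ *ᵥ theta δ n)) * inv_mul_mul_sqrt hn (c n)

lemma BiasHat_sub_Bias (hn : 0 < n) (hS : IsUnit (Sxx (xData x n)).det) (ω : Ω) :
    BiasHat x δ ε c g n ω - Bias x δ c g n = -((n : ℝ)⁻¹ * c n) * (√(n : ℝ) *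
      (g ⬝ᵥ (SxxRidge (c n) (xData x n))⁻¹ *ᵥ ((Sxx (xData x n))⁻¹ *ᵥ
        Sxy (xData x n) (errData ε n ω)))) := by
  rw [BiasHat, Bias, ← ols_sub_theta hS δ, mulVec_sub, dotProduct_sub]
  linear_combination (-(g ⬝ᵥ (SxxRidge (c n) (xData x n))⁻¹ *ᵥ
    ols (xData x n) (yData x δ ε n ω)) + g ⬝ᵥ (SxxRidge (c n) (xData x n))⁻¹ *ᵥ theta δ n) *
    (-inv_mul_mul_sqrt hn (c n))

lemma sqrt_mul_dotProduct_Sxy (hn : 0 < n) (u : Fin p → ℝ) (ω : Ω) :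
    √(n : ℝ) * (u ⬝ᵥ Sxy (xData x n) (errData ε n ω)) =
      ∑ t : Fin n, ((√(n : ℝ))⁻¹ * (u ⬝ᵥ xData x n t)) * ε t ω := by
  have h1 := inv_mul_mul_sqrt hn 1
  rw [mul_one, one_mul] at h1
  rw [Sxy, dotProduct_smul, dotProduct_sum, smul_eq_mul, ← mul_assoc, mul_comm (√(n : ℝ)), h1,
    Finset.mul_sum]
  refine Finset.sum_congr rfl fun t _ => ?_
  rw [dotProduct_smul, smul_eq_mul, errData]
  ring

lemma continuous_Sxy (xs : Fin n → Fin p → ℝ) : Continuous (Sxy xs) := by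
  unfold Sxy
  fun_prop

lemma continuous_dotProduct_mulVec_Sxy (M : Matrix (Fin p) (Fin p) ℝ) (xs : Fin n → Fin p → ℝ) :
    Continuous fun ys => g ⬝ᵥ M *ᵥ Sxy xs ys :=
  continuous_const.dotProduct (continuous_const.matrix_mulVec (continuous_Sxy xs))

lemma measurable_BiasHat_dataSigma : Measurable[dataSigma x δ ε n] (BiasHat x δ ε c g n) := by
  have h : Measurable fun ys : Fin n → ℝ => -(c n) * (√(n : ℝ))⁻¹ *
      (g ⬝ᵥ (SxxRidge (c n) (xData x n))⁻¹ *ᵥ ols (xData x n) ys) := by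
    refine Measurable.const_mul ?_ _
    refine (continuous_const.dotProduct (continuous_const.matrix_mulVec ?_)).measurable
    exact continuous_const.matrix_mulVec (continuous_Sxy _)
  exact h.comp (comap_measurable _)

variable [MeasurableSpace Ω] {P : Measure Ω} {sigma2 c₀ : ℝ} {Sig : Matrix (Fin p) (Fin p) ℝ}

lemma measurable_yData (hε : ∀ t, Measurable (ε t)) : Measurable (yData x δ ε n) :=
  measurable_pi_lambda _ fun t => (hε t).const_add _

lemma measurable_Tstat (hε : ∀ t, Measurable (ε t)) : Measurable (Tstat x δ ε c g r n) := by
  have h := (continuous_dotProduct_mulVec_Sxy (g := g) (SxxRidge (c n) (xData x n))⁻¹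
    (xData x n)).measurable.comp (measurable_yData (x := x) (δ := δ) (n := n) hε)
  exact (h.sub_const (r n)).const_mul _

lemma measurable_BiasHat (hε : ∀ t, Measurable (ε t)) : Measurable (BiasHat x δ ε c g n) :=
  measurable_BiasHat_dataSigma.mono (measurable_yData hε).comap_le le_rfl

/-- Central limit theorem for every linear combination of the centered statistic and of the
estimation error of the bias. -/
lemma RidgeBase.tendsto_charFun_combination [IsProbabilityMeasure P]
    (H : RidgeBase P x ε c sigma2 c₀ Sig)
    (hmax : (fun n : ℕ => ⨆ t : Fin n, xData x n t ⬝ᵥ xData x n t)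
      =o[atTop] fun n : ℕ => (n : ℝ))
    (hnull : ∀ n, 1 ≤ n → g ⬝ᵥ theta δ n = r n) (s : Fin 2 → ℝ) :
    Tendsto (fun n => charFun (P.map fun ω =>
      s 0 * (Tstat x δ ε c g r n ω - Bias x δ c g n) +
      s 1 * (BiasHat x δ ε c g n ω - Bias x δ c g n)) 1) atTop
      (𝓝 (Complex.exp (-((s ⬝ᵥ V g c₀ sigma2 Sig *ᵥ s / 2 : ℝ) : ℂ)))) := by
  set h := (SigTilde c₀ Sig)⁻¹ *ᵥ g with hh
  have hSB := tendsto_SxxRidge H.tendsto_Sxx H.tendsto_c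
  have hTpd := posDef_SigTilde H.posDef H.c₀_nonneg
  have hlimB := tendsto_matrix_inv hSB hTpd
  have hlimS := tendsto_matrix_inv H.tendsto_Sxx H.posDef
  -- the vector of weights of the regressors in the linear combination
  set u : ℕ → Fin p → ℝ := fun n =>
    s 0 • (((SxxRidge (c n) (xData x n))⁻¹)ᵀ *ᵥ g) -
      ((n : ℝ)⁻¹ * c n * s 1) • (((Sxx (xData x n))⁻¹)ᵀ *ᵥ
        (((SxxRidge (c n) (xData x n))⁻¹)ᵀ *ᵥ g)) with hu
  have hulim : Tendsto u atTop (𝓝 (s 0 • h - (c₀ * s 1) • (Sig⁻¹ *ᵥ h))) := by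
    have hcT : Continuous fun M : Matrix (Fin p) (Fin p) ℝ => Mᵀ := continuous_id.matrix_transpose
    have h1 := tendsto_mulVec ((hcT.tendsto _).comp hlimB) (tendsto_const_nhds (x := g))
    have h2 := tendsto_mulVec ((hcT.tendsto _).comp hlimS) h1
    rw [transpose_inv_SigTilde H.posDef H.c₀_nonneg] at h1 h2
    rw [transpose_of_posDef H.posDef.inv] at h2
    exact (h1.const_smul (s 0)).sub ((H.tendsto_c.mul_const (s 1)).smul h2)
  set a : ∀ n : ℕ, Fin n → ℝ := fun n t => (√(n : ℝ))⁻¹ * (u n ⬝ᵥ xData x n t) with ha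
  have hsum : Tendsto (fun n => ∑ t, a n t ^ 2) atTop
      (𝓝 ((s 0 • h - (c₀ * s 1) • (Sig⁻¹ *ᵥ h)) ⬝ᵥ
        Sig *ᵥ (s 0 • h - (c₀ * s 1) • (Sig⁻¹ *ᵥ h)))) := by
    refine (tendsto_dotProduct hulim (tendsto_mulVec H.tendsto_Sxx hulim)).congr fun n => ?_
    rw [Sxx_mulVec, dotProduct_smul, dotProduct_sum, smul_eq_mul, Finset.mul_sum]
    refine Finset.sum_congr rfl fun t _ => ?_
    rw [dotProduct_smul, smul_eq_mul, ha, mul_pow, inv_pow, Real.sq_sqrt (Nat.cast_nonneg n), sq]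
  have hsmall : ∀ η > 0, ∀ᶠ n in atTop, ∀ t, |a n t| < η := by
    intro η hη
    have hlim := (tendsto_dotProduct hulim hulim).mul (tendsto_iSup_div hmax)
    rw [mul_zero] at hlim
    filter_upwards [hlim.eventually_lt_const (show 0 < η ^ 2 by positivity)] with n hn t
    refine abs_lt_of_sq_lt_sq ?_ hη.le
    refine lt_of_le_of_lt ?_ hn
    rw [ha, mul_pow, inv_pow, Real.sq_sqrt (Nat.cast_nonneg n), mul_left_comm]
    refine mul_le_mul_of_nonneg_left ((sq_dotProduct_le _ _).trans ?_) (by positivity)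
    exact mul_le_mul_of_nonneg_left (dotProduct_self_le_iSup x n t) (dotProduct_self_nonneg_real _)
  have : IsProbabilityMeasure (P.map (ε 0)) :=
    Measure.isProbabilityMeasure_map (H.measurable_err 0).aemeasurable
  have hclt := tendsto_prod_charFun H.sigma2_pos.le
    (charFun_sub_exp_isLittleO H.memLp_two H.mean_zero H.integral_sq) hsmall hsum
  rw [← V_quadForm H.posDef H.c₀_nonneg h hh] at hclt
  refine hclt.congr' ?_
  filter_upwards [eventually_ge_atTop 1, eventually_isUnit_det hSB hTpd,
    eventually_isUnit_det H.tendsto_Sxx H.posDef] with n hn hB hS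
  have hcf := charFun_map_sum_mul H.measurable_err H.indep H.identDistrib (a n) 1
  simp only [mul_one] at hcf
  rw [← hcf]
  congr 2
  ext ω
  rw [Tstat_sub_Bias hn (hnull n hn) hB, BiasHat_sub_Bias hn hS, ← sqrt_mul_dotProduct_Sxy hn]
  have hd : ∀ (M : Matrix (Fin p) (Fin p) ℝ) (v w : Fin p → ℝ), v ⬝ᵥ M *ᵥ w = (Mᵀ *ᵥ v) ⬝ᵥ w :=
    fun M v w => by rw [dotProduct_mulVec, mulVec_transpose]
  simp only [hu, hd, sub_dotProduct, smul_dotProduct, smul_eq_mul]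
  ring

/-- Joint convergence in distribution of the centered statistic and of the estimation error of
the bias. -/
lemma RidgeBase.tendstoInDistribution_joint [IsProbabilityMeasure P] {Ω' : Type*}
    [MeasurableSpace Ω'] {P' : Measure Ω'} [IsProbabilityMeasure P'] {ξ₁ ξ₂ : Ω' → ℝ}
    (H : RidgeBase P x ε c sigma2 c₀ Sig)
    (hmax : (fun n : ℕ => ⨆ t : Fin n, xData x n t ⬝ᵥ xData x n t)
      =o[atTop] fun n : ℕ => (n : ℝ))
    (hnull : ∀ n, 1 ≤ n → g ⬝ᵥ theta δ n = r n)
    (hξ : HasLaw (fun ω' => !₂[ξ₁ ω', ξ₂ ω'])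
      (multivariateGaussian 0 (V g c₀ sigma2 Sig)) P') :
    TendstoInDistribution (fun n ω => (Tstat x δ ε c g r n ω - Bias x δ c g n,
      BiasHat x δ ε c g n ω - Bias x δ c g n)) atTop
      (fun ω' => (ξ₁ ω', ξ₂ ω')) (fun _ => P) P' := by
  have hV := V_posSemidef (g := g) H.posDef H.c₀_nonneg H.sigma2_pos
  have hT : ∀ n, Measurable fun ω => Tstat x δ ε c g r n ω - Bias x δ c g n := fun n =>
    (measurable_Tstat H.measurable_err).sub_const _
  have hB : ∀ n, Measurable fun ω => BiasHat x δ ε c g n ω - Bias x δ c g n := fun n =>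
    (measurable_BiasHat H.measurable_err).sub_const _
  have hm : ∀ n, Measurable fun ω => !₂[Tstat x δ ε c g r n ω - Bias x δ c g n,
      BiasHat x δ ε c g n ω - Bias x δ c g n] := fun n => by
    refine (WithLp.measurable_toLp 2 _).comp ?_
    refine measurable_pi_lambda _ fun i => ?_
    fin_cases i
    · exact hT n
    · exact hB n
  have hE : TendstoInDistribution (fun n ω => !₂[Tstat x δ ε c g r n ω - Bias x δ c g n,
      BiasHat x δ ε c g n ω - Bias x δ c g n]) atTop (fun ω' => !₂[ξ₁ ω', ξ₂ ω'])
      (fun _ => P) P' := by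
    refine ⟨fun n => (hm n).aemeasurable, hξ.aemeasurable, ?_⟩
    refine ProbabilityMeasure.tendsto_of_tendsto_charFun fun s => ?_
    have hlim := H.tendsto_charFun_combination hmax hnull s.ofLp
    have hcf : charFun (P'.map fun ω' => !₂[ξ₁ ω', ξ₂ ω']) s =
        Complex.exp (-((s.ofLp ⬝ᵥ V g c₀ sigma2 Sig *ᵥ s.ofLp / 2 : ℝ) : ℂ)) := by
      rw [hξ.map_eq, charFun_multivariateGaussian hV]
      simp
    change Tendsto _ _ (𝓝 (charFun (P'.map fun ω' => !₂[ξ₁ ω', ξ₂ ω']) s))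
    rw [hcf]
    refine hlim.congr fun n => ?_
    have := charFun_map_pair (hT n).aemeasurable (P' := P) (hB n).aemeasurable s 1
    rw [one_smul] at this
    exact this.symm
  exact hE.continuous_comp (g := fun e : EuclideanSpace ℝ (Fin 2) => (e 0, e 1)) (by fun_prop)

/-- Convergence in probability of the bootstrap distribution function. The random moments that
enter `tendsto_cdf_boot` converge in probability, and `tendsto_probFilter_of_seq` transfers the
deterministic statement. -/
lemma RidgeBase.tendsto_cdf_TstatBoot [IsProbabilityMeasure P]
    (H : RidgeBase P x ε c sigma2 c₀ Sig)
    (hmax : (fun n : ℕ => ⨆ t : Fin n, xData x n t ⬝ᵥ xData x n t)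
      =o[atTop] fun n : ℕ => (n : ℝ))
    (hm : Integrable (fun ω => ε 0 ω ^ 4) P) (hg : g ≠ 0) (δ : Fin p → ℝ) (u : ℝ) :
    Tendsto (fun z : Σ _ : ℕ, Ω => (pairsLaw z.1).real
        {j | TstatBoot x δ ε c g z.1 z.2 j - BiasHat x δ ε c g z.1 z.2 ≤ u})
      (probFilter atTop fun _ => P)
      (𝓝 ((gaussianReal 0 (V g c₀ sigma2 Sig 0 0).toNNReal).real (Set.Iic u))) := by
  have h4 := tendsto_fourthMoment H.tendsto_Sxx hmax
  have hM : Tendsto (fun (z : Σ _ : ℕ, Ω) (a b : Fin p) => (z.1 : ℝ)⁻¹ *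
      ∑ t, resid (xData x z.1) (yData x δ ε z.1 z.2) t ^ 2 *
        (xData x z.1 t a * xData x z.1 t b))
      (probFilter atTop fun _ => P) (𝓝 fun a b => sigma2 * Sig a b) := by
    rw [tendsto_pi_nhds]
    intro a
    rw [tendsto_pi_nhds]
    exact fun b => H.tendsto_resid_sq h4 hm δ a b
  have hQ := hM.prodMk_nhds ((H.tendsto_resid_fourth h4 hm δ).prodMk_nhds
    (H.tendsto_ols_sq h4 δ))
  refine tendsto_probFilter_of_seq hQ fun z hz hQz => ?_
  have hQ1 := (continuous_fst.tendsto _).comp hQz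
  have hQ2 := (continuous_snd.fst.tendsto _).comp hQz
  have hQ3 := (continuous_snd.snd.tendsto _).comp hQz
  exact tendsto_cdf_boot (N := fun k => (z k).1) (xs := fun k => xData x (z k).1)
    (ys := fun k => yData x δ ε (z k).1 (z k).2) (c := fun k => c (z k).1) hz
    (H.tendsto_Sxx.comp hz) H.posDef (H.tendsto_c.comp hz) H.c₀_nonneg H.sigma2_pos hg
    (h4.comp hz)
    (fun a b => tendsto_pi_nhds.mp (tendsto_pi_nhds.mp hQ1 a) b) hQ2 hQ3 u

lemma hasLaw_fst {Ω' : Type*} [MeasurableSpace Ω'] {P' : Measure Ω'} [IsProbabilityMeasure P']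
    {ξ₁ ξ₂ : Ω' → ℝ} (hSig : Sig.PosDef) (hc : 0 ≤ c₀) (hs : 0 < sigma2)
    (hξ : HasLaw (fun ω' => !₂[ξ₁ ω', ξ₂ ω'])
      (multivariateGaussian 0 (V g c₀ sigma2 Sig)) P') :
    HasLaw ξ₁ (gaussianReal 0 (V g c₀ sigma2 Sig 0 0).toNNReal) P' := by
  have h := hasLaw_linear_combination (V_posSemidef hSig hc hs) hξ ![1, 0]
  have hv : (![1, 0] : Fin 2 → ℝ) ⬝ᵥ V g c₀ sigma2 Sig *ᵥ ![1, 0] = V g c₀ sigma2 Sig 0 0 := by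
    simp [Matrix.mulVec, dotProduct, Fin.sum_univ_two]
  rw [hv] at h
  simpa only [cons_val_zero, cons_val_one, one_mul, zero_mul, add_zero] using h

/-- The conclusions that need no bootstrap, under `max x_t'x_t = o(n)`. -/
lemma assumption1_and_assumption2ii [IsProbabilityMeasure P] {Ω' : Type*}
    [MeasurableSpace Ω'] {P' : Measure Ω'} [IsProbabilityMeasure P'] {ξ₁ ξ₂ : Ω' → ℝ}
    (H : RidgeBase P x ε c sigma2 c₀ Sig)
    (hmax : (fun n : ℕ => ⨆ t : Fin n, xData x n t ⬝ᵥ xData x n t)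
      =o[atTop] fun n : ℕ => (n : ℝ)) (hg : g ≠ 0)
    (hnull : ∀ n, 1 ≤ n → g ⬝ᵥ theta δ n = r n)
    (hξ : HasLaw (fun ω' => !₂[ξ₁ ω', ξ₂ ω'])
      (multivariateGaussian 0 (V g c₀ sigma2 Sig)) P') :
    Assumption1 P P' (Tstat x δ ε c g r) (fun n _ => Bias x δ c g n) ξ₁ ∧
      Assumption2ii P P' (Tstat x δ ε c g r) (fun n _ => Bias x δ c g n)
        (BiasHat x δ ε c g) ξ₁ ξ₂ := by
  have hV := V_posSemidef (g := g) H.posDef H.c₀_nonneg H.sigma2_pos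
  have hV0 := V_zero_zero_pos H.posDef H.c₀_nonneg H.sigma2_pos hg
  have hjoint := H.tendstoInDistribution_joint hmax hnull hξ
  have hl1 := hasLaw_fst H.posDef H.c₀_nonneg H.sigma2_pos hξ
  have hl2 := hasLaw_linear_combination hV hξ ![0, 1]
  have hl3 := hasLaw_linear_combination hV hξ ![1, -1]
  have hv3 : 0 < (![1, -1] : Fin 2 → ℝ) ⬝ᵥ V g c₀ sigma2 Sig *ᵥ ![1, -1] := by
    have hsub := V_variance_sub (g := g) (sigma2 := sigma2) H.posDef H.c₀_nonneg
    have hpos := mul_pos H.sigma2_pos (quadForm_pos H.posDef.inv hg)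
    have hsym : V g c₀ sigma2 Sig 1 0 = V g c₀ sigma2 Sig 0 1 := by simp [V]
    simp [Matrix.mulVec, dotProduct, Fin.sum_univ_two, hsym]
    linarith
  simp only [cons_val_zero, cons_val_one, one_mul, zero_mul, zero_add, neg_mul,
    ← sub_eq_add_neg] at hl2 hl3
  have hne1 : (V g c₀ sigma2 Sig 0 0).toNNReal ≠ 0 := by simpa using hV0
  exact ⟨⟨hjoint.continuous_comp continuous_fst, centeredAtZero_of_hasLaw hl1,
      continuous_distFun_of_hasLaw hne1 hl1,
      (strictMono_distFun_of_hasLaw hne1 hl1).strictMonoOn _⟩,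
    ⟨hjoint, centeredAtZero_of_hasLaw hl2,
      continuous_distFun_of_hasLaw (by simpa using hv3) hl3⟩⟩

end SampleLimit

end RidgeBootstrap

theorem lemma4 {Ω Ω' : Type*} [MeasurableSpace Ω] [MeasurableSpace Ω']
    (P : Measure Ω) [IsProbabilityMeasure P] (P' : Measure Ω') [IsProbabilityMeasure P']
    {p : ℕ} (x : ℕ → Fin p → ℝ) (δ : Fin p → ℝ) (ε : ℕ → Ω → ℝ) (c : ℕ → ℝ)
    (g : Fin p → ℝ) (r : ℕ → ℝ) (sigma2 c₀ : ℝ) (Sig : Matrix (Fin p) (Fin p) ℝ)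
    (ξ₁ ξ₂ : Ω' → ℝ)
    (hg : g ≠ 0)
    -- the null hypothesis `g'θ = r`
    (hnull : ∀ n, 1 ≤ n → g ⬝ᵥ RidgeBootstrap.theta δ n = r n)
    -- `(ξ₁, ξ₂)' ∼ N(0, V)`
    (hξ : HasLaw (fun ω' => !₂[ξ₁ ω', ξ₂ ω'])
      (multivariateGaussian 0 (RidgeBootstrap.V g c₀ sigma2 Sig)) P') :
    (RidgeBootstrap.AssumptionRE P x ε c sigma2 c₀ Sig →
      RidgeBootstrap.Assumption1 P P' (RidgeBootstrap.Tstat x δ ε c g r)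
        (fun n _ => RidgeBootstrap.Bias x δ c g n) ξ₁ ∧
      RidgeBootstrap.Assumption2ii P P' (RidgeBootstrap.Tstat x δ ε c g r)
        (fun n _ => RidgeBootstrap.Bias x δ c g n) (RidgeBootstrap.BiasHat x δ ε c g) ξ₁ ξ₂) ∧
    (RidgeBootstrap.AssumptionRE2 P x ε c sigma2 c₀ Sig →
      RidgeBootstrap.Assumption1 P P' (RidgeBootstrap.Tstat x δ ε c g r)
        (fun n _ => RidgeBootstrap.Bias x δ c g n) ξ₁ ∧
      RidgeBootstrap.Assumption2 P P' (RidgeBootstrap.dataSigma x δ ε)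
        (fun n _ => RidgeBootstrap.pairsLaw n) (RidgeBootstrap.Tstat x δ ε c g r)
        (fun n _ => RidgeBootstrap.Bias x δ c g n) (RidgeBootstrap.BiasHat x δ ε c g)
        (RidgeBootstrap.TstatBoot x δ ε c g) ξ₁ ξ₂) ∧
    (0 ≤ c₀ → 0 < sigma2 → Sig.PosDef →
      (RidgeBootstrap.V g c₀ sigma2 Sig).PosSemidef ∧
      0 < RidgeBootstrap.V g c₀ sigma2 Sig 0 0 ∧
      (0 < RidgeBootstrap.V g c₀ sigma2 Sig 1 1 ↔ 0 < c₀) ∧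
      ((RidgeBootstrap.V g c₀ sigma2 Sig).PosDef ↔
        0 < c₀ ∧ ¬ ∃ l : ℝ, Sig *ᵥ g = l • g) ∧
      RidgeBootstrap.mSq (RidgeBootstrap.V g c₀ sigma2 Sig) =
        (g ⬝ᵥ Sig⁻¹ *ᵥ g) /
          (g ⬝ᵥ ((RidgeBootstrap.SigTilde c₀ Sig)⁻¹ * Sig *
            (RidgeBootstrap.SigTilde c₀ Sig)⁻¹) *ᵥ g)) ∧
    ContinuousOn
      (fun q : ℝ × ℝ × Matrix (Fin p) (Fin p) ℝ => RidgeBootstrap.V g q.1 q.2.1 q.2.2)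
      {q | 0 ≤ q.1 ∧ 0 < q.2.1 ∧ q.2.2.PosDef} := by
  refine ⟨fun H => ?_, fun H => ?_, fun hc hs hS => ?_, RidgeBootstrap.continuousOn_V⟩
  · exact RidgeBootstrap.assumption1_and_assumption2ii H.toRidgeBase H.max_isLittleO hg hnull hξ
  · have hmax : (fun n : ℕ => ⨆ t : Fin n,
        RidgeBootstrap.xData x n t ⬝ᵥ RidgeBootstrap.xData x n t) =o[atTop]
          fun n : ℕ => (n : ℝ) := by
      refine H.max_isLittleO.trans_isBigO (IsBigO.of_bound 1 ?_)
      filter_upwards [eventually_ge_atTop 1] with n hn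
      have hn' : (1 : ℝ) ≤ n := by exact_mod_cast hn
      rw [one_mul, Real.norm_of_nonneg (Real.sqrt_nonneg _), Real.norm_of_nonneg (by positivity)]
      exact Real.sqrt_le_iff.mpr ⟨by positivity, by nlinarith⟩
    have hab := RidgeBootstrap.assumption1_and_assumption2ii H.toRidgeBase hmax hg hnull hξ
    refine ⟨hab.1, fun n => RidgeBootstrap.measurable_BiasHat_dataSigma, fun u _ => ?_, hab.2⟩
    rw [RidgeBootstrap.tendstoInMeasure_iff_tendsto_probFilter]
    have hl := RidgeBootstrap.hasLaw_fst H.posDef H.c₀_nonneg H.sigma2_pos hξ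
    rw [RidgeBootstrap.distFun_eq_of_hasLaw hl]
    exact tendsto_sub_nhds_zero_iff.mpr
      (H.toRidgeBase.tendsto_cdf_TstatBoot hmax H.fourth_moment hg δ u)
  · exact ⟨RidgeBootstrap.V_posSemidef hS hc hs, RidgeBootstrap.V_zero_zero_pos hS hc hs hg,
      RidgeBootstrap.V_one_one_pos_iff hS hc hs hg, RidgeBootstrap.V_posDef_iff hS hc hs hg,
      RidgeBootstrap.mSq_V hS hc hs⟩
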